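/- **Setting.** Let $B,L,C,B_\epsilon>0$. Let $\mathcal X$ be a measurable space of covariates (for instance a subset of $\mathbb R^{d_0}$), $\mathcal V$ a class of functions $\mathcal X\to\mathbb R$, and $v^*\in\mathcal V$ measurable. Covariates $x_1,x_2,\dots$ are i.i.d. in $\mathcal X$; noises $\epsilon_1,\epsilon_2,\dots$ are i.i.d. with mean zero and distribution function $F$, and independent of the covariates. The valuation in round $t$ is $v_t=v^*(x_t)+\epsilon_t$; the seller sees $x_t$, posts a price $p_t$ and then observes $v_t$ (hence also $y_t=\mathbb 1\{v_t\ge p_t\}$). Put $\mathsf{Rev}_q(p)=p(1-F(p-q))$; let $p^*(x)$ be a maximizer of $\mathsf{Rev}_{v^*(x)}$ over $p\ge 0$, and $\mathrm{Reg}(T)=\sum_{t=1}^T\bigl(\mathsf{Rev}_{v^*(x_t)}(p^*(x_t))-\mathsf{Rev}_{v^*(x_t)}(p_t)\bigr)$. Assume: 1. $|\epsilon_t|\le B_\epsilon$ almost surely, and $v^*(x)\in[B_\epsilon,B-B_\epsilon]$ for all $x\in\mathcal X$; 2. $|F(u)-F(w)|\le L|u-w|$ for all $u,w\in\mathbb R$;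 3. (second-order smoothness) $\mathsf{Rev}_{v^*(x)}(p^*(x))-\mathsf{Rev}_{v^*(x)}(p)\le C(p^*(x)-p)^2$ for all $x\in\mathcal X$ and $p\ge 0$; 4. (adjusted offline regression oracle) a measurable procedure is given which, for every $n\ge1$ and $\delta>0$, maps $n$ i.i.d. samples with the law of $(x_t,v_t)$ to some $\hat v\in\mathcal V$ with $\|\hat v-v^*\|_\infty\le\sqrt{\rho_{\mathcal V}(\delta)/n}$ with probability at least $1-\delta$, where $\rho_{\mathcal V}(\delta)\ge 0$. **Algorithm.** In round $1$ any price in $[0,B]$ is posted. For $k=1,2,\dots$, episode $k$ consists of the $T_k=2^{k-1}$ rounds $2^{k-1}+1,\dots,2^k$. There is no exploration phase: $\hat v_1\equiv0$, and for $k\ge2$, $\hat v_k$ is the output of the oracle, at level $\delta$, on the $T_{k-1}$ pairs $(x_t,v_t)$ of episode $k-1$. Let $N=N_k=\lceil T_k^{1/5}\rceil$ and $S=S_k=\max\{1,\lceil\frac12\log_2T_k\rceil\}$, and let $m_1,\dots,m_N$ be the midpoints of the $N$ equal subintervals of $[-\|\hat v_k\|_\infty,B+\|\hat v_k\|_\infty]$.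 Each round $t$ of the episode runs as follows (UCB with layered data partitioning). For a layer $s$ and an index $j\in\{1,\dots,N\}$ let $\Psi_t^s(j)$ be the set of earlier rounds of the episode that stopped in layer $s$ with index $j$, let $w^j_{t,s}$ be the mean of $y_\tau$ over $\tau\in\Psi_t^s(j)$, $r^j_{t,s}=\min\{\sqrt{2\ln(2SNT_k/\delta)/|\Psi_t^s(j)|},1\}$ (with $w^j_{t,s}=0$ and $r^j_{t,s}=1$ if $\Psi_t^s(j)=\emptyset$), $p_j=m_j+\hat v_k(x_t)$ and $\mathrm{UCB}^j_{t,s}=p_j(w^j_{t,s}+r^j_{t,s})$. Start with $s=1$ and $\mathcal A_1=\{j:0<p_j<B\}$ (if $\mathcal A_1=\emptyset$, post any price in $[0,B]$ and assign the round to no layer). If $s=S$, choose $j_t\in\arg\max_{j\in\mathcal A_s}\mathrm{UCB}^j_{t,s}$ and stop. If $s<S$ and $p_jr^j_{t,s}>B2^{-s}$ for some $j\in\mathcal A_s$, choose any such $j$ as $j_t$ and stop. Otherwise put $\mathcal A_{s+1}=\{j\in\mathcal A_s:\mathrm{UCB}^j_{t,s}\ge\max_{j'\in\mathcal A_s}\mathrm{UCB}^{j'}_{t,s}-B2^{1-s}\}$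 and pass to layer $s+1$. The posted price is $p_t=m_{j_t}+\hat v_k(x_t)$, and the round is recorded in the layer where the traversal stopped. Choices left open may depend measurably on the past observations and the current covariate. **Claim.** $\mathrm{Reg}(T)=\tilde{\mathcal O}\bigl(T^{3/5}\vee\rho_{\mathcal V}^{1/2}(\delta)T^{1/2}\bigr)$ with probability at least $1-2\lceil\log_2T\rceil\delta$. Precisely: there are an absolute exponent $a\in\mathbb N$ and, for all $B,L,C>0$, a constant $c>0$ depending only on $B,L,C$ such that in every setting as above, for every integer $T\ge2$ and every $0<\delta<1/(2\lceil\log_2T\rceil)$, with probability at least $1-2\lceil\log_2T\rceil\delta$, $$\mathrm{Reg}(T)\le c\,\bigl(\ln(T/\delta)\bigr)^a\max\bigl\{T^{3/5},\ \rho_{\mathcal V}(\delta)^{1/2}\,T^{1/2}\bigr\}.$$ -/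

import Mathlib

/-!
Contextual dynamic pricing with observable valuations.

Rounds are numbered from `0` here: index `t` is the `(t + 1)`-st round. Hence the `k`-th episode,
which consists of the rounds `2 ^ (k - 1) + 1, …, 2 ^ k`, is the set of indices `t` with
`2 ^ e ≤ t < 2 ^ (e + 1)`, where `e = k - 1 = Nat.log 2 t`, and its length is `2 ^ e`.
Index `0` (the very first round) precedes the first episode.
-/

namespace ContextualPricing

/-- Expected revenue `Rev_q(p) = p (1 - F (p - q))` of the price `p` at mean valuation `q`. -/
def rev (F : ℝ → ℝ) (q p : ℝ) : ℝ := p * (1 - F (p - q))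

/-- The supremum norm of a bounded real function. -/
noncomputable def supNorm {X : Type*} (f : X → ℝ) : ℝ := ⨆ x, |f x|

/-- The joint law of `(x, v)` when `x ∼ PX`, `ε ∼ ν` are independent and `v = vstar x + ε`. -/
noncomputable def sampleLaw {X : Type*} [MeasurableSpace X] (PX : MeasureTheory.Measure X)
    (ν : MeasureTheory.Measure ℝ) (vstar : X → ℝ) : MeasureTheory.Measure (X × ℝ) :=
  (PX.prod ν).map (fun q => (q.1, vstar q.1 + q.2))

/-- An offline regression procedure: sample size, confidence level and sample are mapped to a
predictor. -/
abbrev Oracle (X : Type*) : Type _ := (n : ℕ) → ℝ → (Fin n → X × ℝ) → X → ℝ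

/-- The procedure `oracle` is an adjusted offline regression oracle with complexity `ρ` for the class
`𝒱`, for i.i.d. samples `(x, v)` from `Q`, whose regression function is `vstar`: it always outputs
a member of `𝒱`, and `‖v̂ - vstar‖_∞ ≤ √(ρ(δ) / n)` holds with probability at least `1 - δ`. The
first two clauses are the measurability of the procedure. -/
structure IsAdjustedOracle {X : Type*} [MeasurableSpace X] (𝒱 : Set (X → ℝ))
    (Q : MeasureTheory.Measure (X × ℝ)) (vstar : X → ℝ) (ρ : ℝ → ℝ) (oracle : Oracle X) :
    Prop where
  measurable_eval : ∀ (n : ℕ) (δ : ℝ), 1 ≤ n → 0 < δ →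
    Measurable (fun q : (Fin n → X × ℝ) × X => oracle n δ q.1 q.2)
  measurable_supNorm : ∀ (n : ℕ) (δ : ℝ), 1 ≤ n → 0 < δ →
    Measurable (fun D : Fin n → X × ℝ => supNorm (oracle n δ D))
  mem_class : ∀ (n : ℕ) (δ : ℝ), 1 ≤ n → 0 < δ → ∀ D : Fin n → X × ℝ, oracle n δ D ∈ 𝒱
  accuracy : ∀ (n : ℕ) (δ : ℝ), 1 ≤ n → 0 < δ →
    (MeasureTheory.Measure.pi (fun _ : Fin n => Q))
      {D | ¬ ∀ x, |oracle n δ D x - vstar x| ≤ √(ρ δ / n)} ≤ ENNReal.ofReal δ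

/-- How the seller makes the choices that the algorithm leaves open. At index `t` it may use all past
observations and the current context. `pick` chooses an index from a nonempty set of admissible
indices (an arbitrary under-explored index, or one of the maximizers of the upper confidence
bound); `fallback` is a price in `[0, B]` for a round in which the algorithm prescribes none (the
very first round, and a round in which no grid price lies in `(0, B)`). -/
structure SelectionRule (X : Type*) [MeasurableSpace X] (B : ℝ) where
  pick : (t : ℕ) → (Fin t → X × ℝ) → X → Finset ℕ → ℕ
  pick_mem : ∀ (t : ℕ) (h : Fin t → X × ℝ) (x : X) (A : Finset ℕ), A.Nonempty → pick t h x A ∈ A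
  measurable_pick : ∀ (t : ℕ) (A : Finset ℕ),
    Measurable (fun q : (Fin t → X × ℝ) × X => pick t q.1 q.2 A)
  fallback : (t : ℕ) → (Fin t → X × ℝ) → X → ℝ
  fallback_mem : ∀ (t : ℕ) (h : Fin t → X × ℝ) (x : X), fallback t h x ∈ Set.Icc 0 B
  measurable_fallback : ∀ t : ℕ,
    Measurable (fun q : (Fin t → X × ℝ) × X => fallback t q.1 q.2)

/-- The outcome of a round: stopping layer, chosen grid index, posted price. Layer `0` means that the
round belongs to no layer. -/
structure Decision where
  layer : ℕ
  arm : ℕ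
  price : ℝ

/-! ### One round of UCB with layered data partitioning -/

/-- Midpoint `m_j`, `1 ≤ j ≤ N`, of the `j`-th of the `N` equal pieces of `[-V, B + V]`. -/
noncomputable def gridPoint (B V : ℝ) (N j : ℕ) : ℝ :=
  -V + ((j : ℝ) - 1 / 2) * ((B + 2 * V) / N)

/-- Number of layers `⌈(1/2) log₂ T⌉` (one layer if `T = 1`). -/
noncomputable def numLayers (T : ℕ) : ℕ := max 1 ⌈Real.logb 2 T / 2⌉₊

/-- Confidence radius after `n` samples; it is `1` if `n = 0`. -/
noncomputable def radius (δ : ℝ) (S N T n : ℕ) : ℝ :=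
  if n = 0 then 1 else min √(2 * Real.log (2 * S * N * T / δ) / n) 1

/-- The set `Ψ_t^s(j)` of the previous rounds of the episode beginning at index `t₀` that stopped in
layer `s` and used the grid index `j`. (The grid points being distinct, the last condition says
that the posted price was `m_j + v̂(x_τ)`.) -/
def layerRounds {t : ℕ} (t₀ : ℕ) (past : Fin t → Decision) (s j : ℕ) : Finset (Fin t) :=
  Finset.univ.filter (fun τ => t₀ ≤ (τ : ℕ) ∧ (past τ).layer = s ∧ (past τ).arm = j)

/-- The sale outcome `y_τ = 𝟙{v_τ ≥ p_τ}`. -/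
noncomputable def sale (v p : ℝ) : ℝ := if p ≤ v then 1 else 0

/-- The sample mean `w_{t,s}^j` of the sale outcomes over `Ψ_t^s(j)` (it is `0` if that is empty). -/
noncomputable def sampleMean {X : Type*} {t : ℕ} (t₀ : ℕ) (h : Fin t → X × ℝ)
    (past : Fin t → Decision) (s j : ℕ) : ℝ :=
  (∑ τ ∈ layerRounds t₀ past s j, sale (h τ).2 (past τ).price) / (layerRounds t₀ past s j).card

/-- Indices in `A` that fail the statistical precision check of layer `s`; `width s j` stands for
`(m_j + v̂(x_t)) r_{t,s}^j`. -/
noncomputable def underExplored (B : ℝ) (width : ℕ → ℕ → ℝ) (s : ℕ) (A : Finset ℕ) : Finset ℕ :=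
  A.filter (fun j => B / 2 ^ s < width s j)

/-- Price elimination in layer `s`: keep the `j` with `UCB_j ≥ max_{j' ∈ A} UCB_{j'} - B 2^{1-s}`. -/
noncomputable def eliminate (B : ℝ) (U : ℕ → ℕ → ℝ) (s : ℕ) (A : Finset ℕ) : Finset ℕ :=
  A.filter (fun j => ∀ j' ∈ A, U s j' - 2 * B / 2 ^ s ≤ U s j)

/-- Maximizers of the upper confidence bound over `A`. -/
noncomputable def maximizers (U : ℕ → ℕ → ℝ) (s : ℕ) (A : Finset ℕ) : Finset ℕ :=
  A.filter (fun j => ∀ j' ∈ A, U s j' ≤ U s j)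

/-- The layer traversal, from layer `s` with the candidate set `A`, when `n` further layers remain
(so `s + n` is the last layer). It returns the stopping layer and the set of the indices
that may be chosen there. -/
noncomputable def layerTraversal (B : ℝ) (width U : ℕ → ℕ → ℝ) : ℕ → ℕ → Finset ℕ → ℕ × Finset ℕ
  | 0, s, A => (s, maximizers U s A)
  | n + 1, s, A =>
      if (underExplored B width s A).Nonempty then (s, underExplored B width s A)
      else layerTraversal B width U n (s + 1) (eliminate B U s A)

/-- One round of UCB-LDP with estimator `vhat`, `N` grid points, length `T`, price bound `B` and
confidence parameter `δ`, in the episode beginning at index `t₀`. Here `h` lists the past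
observations `(x_τ, v_τ)`, `past` the past decisions, and `x` is the current context. For an index
without samples the sample mean is `0` and the radius is `1`, so its upper bound `U` is its price. -/
noncomputable def ucbLdpRound {X : Type*} [MeasurableSpace X] {B : ℝ} (R : SelectionRule X B)
    (δ : ℝ) (N T : ℕ) (vhat : X → ℝ) (t₀ t : ℕ) (h : Fin t → X × ℝ) (past : Fin t → Decision)
    (x : X) : Decision :=
  let price : ℕ → ℝ := fun j => gridPoint B (supNorm vhat) N j + vhat x
  let r : ℕ → ℕ → ℝ := fun s j => radius δ (numLayers T) N T (layerRounds t₀ past s j).card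
  let width : ℕ → ℕ → ℝ := fun s j => price j * r s j
  let U : ℕ → ℕ → ℝ := fun s j => price j * (sampleMean t₀ h past s j + r s j)
  let A₁ : Finset ℕ := (Finset.Icc 1 N).filter (fun j => 0 < price j ∧ price j < B)
  if A₁.Nonempty then
    let out := layerTraversal B width U (numLayers T - 1) 1 A₁
    let j := R.pick t h x out.2
    ⟨out.1, j, price j⟩
  else ⟨0, 0, R.fallback t h x⟩

/-! ### The pricing algorithm -/

/-- Discretization number `⌈T^{1/5}⌉` of an episode of length `T`. -/
noncomputable def numGrid (T : ℕ) : ℕ := ⌈(T : ℝ) ^ (1 / 5 : ℝ)⌉₊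

/-- The estimator used in episode `k = e + 1`: zero in the first episode, and then the oracle's output
on the `2 ^ (e - 1)` observations `(x, v)` of the previous episode. -/
def estimator {X : Type*} (oracle : Oracle X) (δ : ℝ) (obs : ℕ → X × ℝ) (e : ℕ) : X → ℝ :=
  if e = 0 then fun _ => 0
  else oracle (2 ^ (e - 1)) δ (fun i => obs (2 ^ (e - 1) + i))

/-- The decision of the algorithm at index `t` along the sequence `obs` of pairs `(x_τ, v_τ)`. It uses
only the pairs with `τ < t` and the current context `x_t`. -/
noncomputable def decision {X : Type*} [MeasurableSpace X] {B : ℝ} (R : SelectionRule X B)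
    (oracle : Oracle X) (δ : ℝ) (obs : ℕ → X × ℝ) (t : ℕ) : Decision :=
  if t = 0 then ⟨0, 0, R.fallback t (fun i => obs i) (obs t).1⟩
  else
    ucbLdpRound R δ (numGrid (2 ^ Nat.log 2 t)) (2 ^ Nat.log 2 t)
      (estimator oracle δ obs (Nat.log 2 t)) (2 ^ Nat.log 2 t) t (fun i => obs i)
      (fun τ : Fin t => decision R oracle δ obs τ) (obs t).1
termination_by t
decreasing_by exact τ.isLt

/-- Cumulative regret of the algorithm over the first `T` rounds, `pstar x` being the optimal price at
the context `x`. -/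
noncomputable def regret {X : Type*} [MeasurableSpace X] {B : ℝ} (R : SelectionRule X B)
    (oracle : Oracle X) (δ : ℝ) (F : ℝ → ℝ) (vstar pstar : X → ℝ) (obs : ℕ → X × ℝ) (T : ℕ) : ℝ :=
  ∑ t ∈ Finset.range T, (rev F (vstar (obs t).1) (pstar (obs t).1) -
    rev F (vstar (obs t).1) (decision R oracle δ obs t).price)

end ContextualPricing

namespace ContextualPricing

/-! ### The layer traversal -/

/-! Why the bound holds. Within an episode the index `j` stands for the offset `m_j`, not for a
price. Its price `m_j + v̂(x)` has demand `1 - F(m_j + v̂(x) - v*(x))`. If `‖v̂ - v*‖ ≤ ε`, the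
Lipschitz condition makes this demand the same in all rounds up to `2Lε`. So the `N` indices form a
bandit whose demands do not depend on the context, up to a misspecification, although the revenues
do depend on it.

Three losses arise in an episode of length `T`. The grid misses the optimal price by at most a
constant times `1/N`, which by second-order smoothness costs order `T/N²` in total. The
misspecification costs order `ε` per round and layer, and `ε = √(ρ/(T/2))` gives order `√(ρT)`. In
the bandit part, a round stopping in layer `s` loses at most `8B/2^s` besides these errors
(`layerTraversal_value`). Before the last layer each index stops there `O(4^s log)` times
(`card_stopRounds_le`), since each stop certifies a radius above `2^{-s}`. Combined with the trivial
count `T`, a layer costs order `√(NT)` up to logarithms (`sum_layer_resolution_le`). The choice `N ≈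
T^{1/5}` balances `√(NT)` with `T/N²` at `T^{3/5}`.

Confidence does not rest on independence of the samples within a layer. The price depends only on
the past and the current context, and the current noise is independent of both. Hence sales minus
conditional demand, summed over the rounds of one layer and index, carry an exponential
supermartingale (`lintegral_exp_expDeviation_le`). Markov's inequality and a union bound give
`measure_not_concentrates_le`. With the oracle event this costs `2δ` per episode, and `regret_le` is
deterministic on the remaining event. -/

theorem layerTraversal_structure (B : ℝ) (width U : ℕ → ℕ → ℝ) :
    ∀ (n s : ℕ) (A : Finset ℕ), A.Nonempty → 0 ≤ B →
      (layerTraversal B width U n s A).2.Nonempty ∧ (layerTraversal B width U n s A).2 ⊆ A ∧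
      s ≤ (layerTraversal B width U n s A).1 ∧ (layerTraversal B width U n s A).1 ≤ s + n ∧
      ((layerTraversal B width U n s A).1 < s + n → ∀ j ∈ (layerTraversal B width U n s A).2,
        B / 2 ^ (layerTraversal B width U n s A).1 <
          width (layerTraversal B width U n s A).1 j) := by
  intro n
  induction n with
  | zero =>
    intro s A hA hB
    obtain ⟨j, hj, hmax⟩ := Finset.exists_max_image A (U s) hA
    refine ⟨⟨j, by simp [layerTraversal, maximizers, hj]; exact hmax⟩, ?_, le_rfl, le_rfl, ?_⟩
    · exact Finset.filter_subset _ _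
    · intro h; simp [layerTraversal] at h
  | succ n ih =>
    intro s A hA hB
    rw [layerTraversal]
    split_ifs with h
    · refine ⟨h, Finset.filter_subset _ _, le_rfl, by simp, ?_⟩
      intro _ j hj
      exact (Finset.mem_filter.1 hj).2
    · obtain ⟨j, hj, hmax⟩ := Finset.exists_max_image A (U s) hA
      have hne : (eliminate B U s A).Nonempty := by
        refine ⟨j, Finset.mem_filter.2 ⟨hj, fun j' hj' => ?_⟩⟩
        have := hmax j' hj'
        have : 0 ≤ 2 * B / 2 ^ s := by positivity
        linarith
      obtain ⟨h1, h2, h3, h4, h5⟩ := ih (s + 1) _ hne hB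
      refine ⟨h1, h2.trans (Finset.filter_subset _ _), by omega, by omega, ?_⟩
      intro h6
      exact h5 (by omega)

/-- Under a misspecification `η` of the confidence bounds, every index that may be chosen is optimal
up to the resolution of the stopping layer and the accumulated misspecification. -/
theorem layerTraversal_value {B η M : ℝ} (width U : ℕ → ℕ → ℝ) (v : ℕ → ℝ) (S : ℕ)
    (hB : 0 ≤ B) (hη : 0 ≤ η) (A₁ : Finset ℕ)
    (hlow : ∀ s ≤ S, 1 ≤ s → ∀ j ∈ A₁, v j - η ≤ U s j)
    (hup : ∀ s ≤ S, 1 ≤ s → ∀ j ∈ A₁, U s j ≤ v j + 2 * width s j + η) :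
    ∀ (n s : ℕ) (A : Finset ℕ), A ⊆ A₁ → 1 ≤ s → s + n ≤ S →
      (∃ j ∈ A, M - 2 * η * s ≤ v j) → (∀ j ∈ A, M - 8 * B / 2 ^ s - 2 * η * s ≤ v j) →
      ∀ j ∈ (layerTraversal B width U n s A).2,
        M - 8 * B / 2 ^ (layerTraversal B width U n s A).1 -
          2 * η * (layerTraversal B width U n s A).1 ≤ v j := by
  intro n
  induction n with
  | zero =>
    intro s A hA hs hS htop hall j hj
    exact hall j (Finset.filter_subset _ _ hj)
  | succ n ih =>
    intro s A hA hs hS htop hall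
    rw [layerTraversal]
    split_ifs with h
    · intro j hj
      exact hall j (Finset.filter_subset _ _ hj)
    · obtain ⟨j₀, hj₀, hM⟩ := htop
      have hw : ∀ j ∈ A, width s j ≤ B / 2 ^ s := by
        intro j hj
        by_contra hlt
        exact h ⟨j, Finset.mem_filter.2 ⟨hj, not_le.1 hlt⟩⟩
      obtain ⟨jm, hjm, hmax⟩ := Finset.exists_max_image A (U s) ⟨j₀, hj₀⟩
      have hBs : 0 ≤ B / 2 ^ s := by positivity
      have e1 : 2 * B / 2 ^ s = 2 * (B / 2 ^ s) := by ring
      have e2 : 8 * B / 2 ^ (s + 1) = 4 * (B / 2 ^ s) := by rw [pow_succ]; field_simp; ring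
      have hl := fun j (hj : j ∈ A) => hlow s (by omega) hs j (hA hj)
      have hu := fun j (hj : j ∈ A) => hup s (by omega) hs j (hA hj)
      refine ih (s + 1) _ ((Finset.filter_subset _ _).trans hA) (by omega) (by omega) ?_ ?_
      · push_cast
        -- If the near-optimal `j₀` is eliminated, the maximizer `jm` of the upper bound takes its
        -- place. Elimination needs a gap of `2B/2^s`, and the widths, at most `B/2^s`, can account
        -- for exactly that much. So `jm` is worse than `j₀` by at most `2η`.
        by_cases hj₀' : j₀ ∈ eliminate B U s A
        · exact ⟨j₀, hj₀', by nlinarith⟩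
        · refine ⟨jm, Finset.mem_filter.2 ⟨hjm, fun j' hj' => ?_⟩, ?_⟩
          · have := hmax j' hj'
            rw [e1]; linarith
          · simp only [eliminate, Finset.mem_filter, hj₀, true_and, not_forall, not_le] at hj₀'
            obtain ⟨j', hj', hlt⟩ := hj₀'
            have h1 := hmax j' hj'
            have h2 := hu jm hjm
            have h3 := hw jm hjm
            have h4 := hl j₀ hj₀
            rw [e1] at hlt
            nlinarith
      -- A survivor loses `2B/2^s` by the elimination rule and `2B/2^s` by its own width. The sum
      -- `4B/2^s` is `8B/2^(s+1)`.
      · intro j hj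
        obtain ⟨hjA, hj⟩ := Finset.mem_filter.1 hj
        have h1 := hj j₀ hj₀
        have h2 := hu j hjA
        have h3 := hw j hjA
        have h4 := hl j₀ hj₀
        rw [e1] at h1
        rw [e2]
        push_cast
        nlinarith

/-! ### The price grid -/

theorem gridPoint_near {B V h q : ℝ} {N : ℕ} (hN : 0 < N) (hh : h = (B + 2 * V) / N)
    (hq : q ∈ Set.Icc (-V) (B + V)) (hBV : 0 < B + 2 * V) :
    ∃ j ∈ Finset.Icc 1 N, |gridPoint B V N j - q| ≤ h / 2 := by
  have hN' : (0 : ℝ) < N := by exact_mod_cast hN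
  have hh0 : 0 < h := by rw [hh]; positivity
  have hNh : N * h = B + 2 * V := by rw [hh]; field_simp
  have hgrid : ∀ j : ℕ, gridPoint B V N j = -V + ((j : ℝ) - 1 / 2) * h := by
    intro j; rw [hh]; rfl
  obtain ⟨hq1, hq2⟩ := hq
  have hu0 : 0 ≤ (q + V) / h := div_nonneg (by linarith) hh0.le
  have huq : (q + V) / h * h = q + V := by field_simp
  by_cases hlt : ⌊(q + V) / h⌋₊ < N
  · refine ⟨⌊(q + V) / h⌋₊ + 1, Finset.mem_Icc.2 ⟨by omega, by omega⟩, ?_⟩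
    have h1 := Nat.floor_le hu0
    have h2 := Nat.lt_floor_add_one ((q + V) / h)
    rw [hgrid, abs_le]
    push_cast
    constructor <;> nlinarith
  -- This is the right endpoint `q = B + V`, which belongs to the last cell.
  · refine ⟨N, Finset.mem_Icc.2 ⟨hN, le_rfl⟩, ?_⟩
    rw [hgrid]
    rw [abs_le]
    have h1 : (N : ℝ) ≤ (q + V) / h := by
      have : (N : ℝ) ≤ ⌊(q + V) / h⌋₊ := by exact_mod_cast not_lt.1 hlt
      exact this.trans (Nat.floor_le hu0)
    have : N * h ≤ q + V := by rw [← huq]; exact mul_le_mul_of_nonneg_right h1 hh0.le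
    constructor <;> nlinarith

/-- A price in `[0, B]` is approximated within the open interval `(0, B)` by the shifted grid. -/
theorem exists_grid_price_near {B V h q w : ℝ} {N : ℕ} (hN : 0 < N) (hh : h = (B + 2 * V) / N)
    (hB : 0 < B) (hw : |w| ≤ V) (hq : q ∈ Set.Icc 0 B) (hhB : h ≤ B / 2) :
    ∃ j ∈ Finset.Icc 1 N, 0 < gridPoint B V N j + w ∧ gridPoint B V N j + w < B ∧
      |q - (gridPoint B V N j + w)| ≤ 3 / 2 * h := by
  have hV : 0 ≤ V := (abs_nonneg w).trans hw
  have hh0 : 0 < h := by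
    have : (0 : ℝ) < N := by exact_mod_cast hN
    rw [hh]; positivity
  obtain ⟨hw1, hw2⟩ := abs_le.1 hw
  obtain ⟨hq1, hq2⟩ := hq
  -- Clamping `q` to `[h, B - h]` costs at most `h`. Rounding then moves the price by `h / 2`, which
  -- cannot leave the open interval `(0, B)`.
  obtain ⟨r, hr1, hr2, hr3, hr4⟩ : ∃ r, h ≤ r ∧ r ≤ B - h ∧ q - r ≤ h ∧ r - q ≤ h := by
    rcases le_total q h with h1 | h1
    · exact ⟨h, le_rfl, by linarith, by linarith, by linarith⟩
    · rcases le_total q (B - h) with h2 | h2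
      · exact ⟨q, h1, h2, by linarith, by linarith⟩
      · exact ⟨B - h, by linarith, le_rfl, by linarith, by linarith⟩
  obtain ⟨j, hj, hjr⟩ := gridPoint_near (q := r - w) hN hh ⟨by linarith, by linarith⟩
    (by linarith)
  obtain ⟨h1, h2⟩ := abs_le.1 hjr
  refine ⟨j, hj, by linarith, by linarith, abs_le.2 ⟨by linarith, by linarith⟩⟩

/-! ### The decisions within an episode -/

section Episode

variable {X : Type*} [MeasurableSpace X] {B : ℝ} (R : SelectionRule X B) (oracle : Oracle X)
  (δ : ℝ) (obs : ℕ → X × ℝ)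

/-- The rounds of the index interval `[t₀, t)` that stop in layer `s` with index `j`. -/
noncomputable def stopRounds (t₀ t s j : ℕ) : Finset ℕ :=
  (Finset.Ico t₀ t).filter (fun τ => (decision R oracle δ obs τ).layer = s ∧
    (decision R oracle δ obs τ).arm = j)

/-- The algorithm indexes its past by `Fin t`. The analysis compares the same layer at different
times, for which subsets of `ℕ` are convenient. -/
theorem sum_layerRounds {M : Type*} [AddCommMonoid M] (t₀ t s j : ℕ) (f : ℕ → M) :
    ∑ τ ∈ layerRounds t₀ (fun τ : Fin t => decision R oracle δ obs τ) s j, f τ =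
      ∑ τ ∈ stopRounds R oracle δ obs t₀ t s j, f τ := by
  rw [layerRounds, Finset.sum_filter, stopRounds]
  rw [Fin.sum_univ_eq_sum_range (fun τ => if t₀ ≤ τ ∧ (decision R oracle δ obs τ).layer = s ∧
    (decision R oracle δ obs τ).arm = j then f τ else 0) t, ← Finset.sum_filter]
  congr 1
  ext τ
  simp only [Finset.mem_filter, Finset.mem_range, Finset.mem_Ico]
  tauto

theorem card_layerRounds (t₀ t s j : ℕ) :
    (layerRounds t₀ (fun τ : Fin t => decision R oracle δ obs τ) s j).card =
      (stopRounds R oracle δ obs t₀ t s j).card := by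
  rw [Finset.card_eq_sum_ones, Finset.card_eq_sum_ones]
  exact sum_layerRounds R oracle δ obs t₀ t s j (fun _ => 1)

/-- The price attached to the index `j` at index `t` of episode `e`. -/
noncomputable def armPrice (B : ℝ) (e t j : ℕ) : ℝ :=
  gridPoint B (supNorm (estimator oracle δ obs e)) (numGrid (2 ^ e)) j +
    estimator oracle δ obs e (obs t).1

/-- The confidence radius of the index `j` in layer `s` at index `t` of episode `e`. -/
noncomputable def armRadius (e t s j : ℕ) : ℝ :=
  radius δ (numLayers (2 ^ e)) (numGrid (2 ^ e)) (2 ^ e)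
    (stopRounds R oracle δ obs (2 ^ e) t s j).card

/-- The sample mean of the index `j` in layer `s` at index `t` of episode `e`. -/
noncomputable def armMean (e t s j : ℕ) : ℝ :=
  (∑ τ ∈ stopRounds R oracle δ obs (2 ^ e) t s j,
    sale (obs τ).2 (decision R oracle δ obs τ).price) /
      (stopRounds R oracle δ obs (2 ^ e) t s j).card

/-- The initial candidate set at index `t` of episode `e`. -/
noncomputable def candidates (B : ℝ) (e t : ℕ) : Finset ℕ :=
  (Finset.Icc 1 (numGrid (2 ^ e))).filter
    (fun j => 0 < armPrice oracle δ obs B e t j ∧ armPrice oracle δ obs B e t j < B)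

/-- The outcome of the layer traversal at index `t` of episode `e`. -/
noncomputable def traversal (e t : ℕ) : ℕ × Finset ℕ :=
  layerTraversal B (fun s j => armPrice oracle δ obs B e t j * armRadius R oracle δ obs e t s j)
    (fun s j => armPrice oracle δ obs B e t j *
      (armMean R oracle δ obs e t s j + armRadius R oracle δ obs e t s j))
    (numLayers (2 ^ e) - 1) 1 (candidates oracle δ obs B e t)

/-- The index chosen at index `t` of episode `e` if there are candidates. -/
noncomputable def chosenArm (e t : ℕ) : ℕ :=
  R.pick t (fun i : Fin t => obs i) (obs t).1 (traversal R oracle δ obs e t).2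

theorem decision_zero :
    decision R oracle δ obs 0 = ⟨0, 0, R.fallback 0 (fun i => obs i) (obs 0).1⟩ := by
  rw [decision]; simp

/-- Replaces the well-founded recursion by quantities that depend on the past only through
`stopRounds`. -/
theorem decision_eq {e t : ℕ} (h1 : 2 ^ e ≤ t) (h2 : t < 2 ^ (e + 1)) :
    decision R oracle δ obs t =
      if (candidates oracle δ obs B e t).Nonempty then
        ⟨(traversal R oracle δ obs e t).1, chosenArm R oracle δ obs e t,
          armPrice oracle δ obs B e t (chosenArm R oracle δ obs e t)⟩
      else ⟨0, 0, R.fallback t (fun i => obs i) (obs t).1⟩ := by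
  have ht : t ≠ 0 := by have := Nat.one_le_two_pow (n := e); omega
  have hlog : Nat.log 2 t = e := by
    rw [Nat.log_eq_iff (Or.inr ⟨by norm_num, ht⟩)]; exact ⟨h1, h2⟩
  rw [decision, if_neg ht, hlog]
  simp only [ucbLdpRound, card_layerRounds, sampleMean,
    sum_layerRounds R oracle δ obs (2 ^ e) t _ _
      (fun τ => sale (obs τ).2 (decision R oracle δ obs τ).price)]
  rfl

end Episode


/-! ### Admissible prices and the number of stops in a layer. -/

section Episode

variable {X : Type*} [MeasurableSpace X] {B : ℝ} (R : SelectionRule X B) (oracle : Oracle X)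
  (δ : ℝ) (obs : ℕ → X × ℝ)

theorem one_le_numLayers (T : ℕ) : 1 ≤ numLayers T := le_max_left _ _

theorem numGrid_pos {T : ℕ} (hT : 0 < T) : 0 < numGrid T := by
  have : (0 : ℝ) < T := by exact_mod_cast hT
  exact Nat.ceil_pos.2 (by positivity)

theorem decision_of_nonempty (hB : 0 ≤ B) {e t : ℕ} (h1 : 2 ^ e ≤ t) (h2 : t < 2 ^ (e + 1))
    (h : (candidates oracle δ obs B e t).Nonempty) :
    decision R oracle δ obs t = ⟨(traversal R oracle δ obs e t).1, chosenArm R oracle δ obs e t,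
      armPrice oracle δ obs B e t (chosenArm R oracle δ obs e t)⟩ ∧
    chosenArm R oracle δ obs e t ∈ (traversal R oracle δ obs e t).2 ∧
    chosenArm R oracle δ obs e t ∈ candidates oracle δ obs B e t ∧
    1 ≤ (traversal R oracle δ obs e t).1 ∧
    (traversal R oracle δ obs e t).1 ≤ numLayers (2 ^ e) ∧
    ((traversal R oracle δ obs e t).1 < numLayers (2 ^ e) →
      B / 2 ^ (traversal R oracle δ obs e t).1 <
        armPrice oracle δ obs B e t (chosenArm R oracle δ obs e t) *
          armRadius R oracle δ obs e t (traversal R oracle δ obs e t).1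
            (chosenArm R oracle δ obs e t)) := by
  obtain ⟨a1, a2, a3, a4, a5⟩ := layerTraversal_structure B
    (fun s j => armPrice oracle δ obs B e t j * armRadius R oracle δ obs e t s j)
    (fun s j => armPrice oracle δ obs B e t j *
      (armMean R oracle δ obs e t s j + armRadius R oracle δ obs e t s j))
    (numLayers (2 ^ e) - 1) 1 (candidates oracle δ obs B e t) h hB
  have hS := one_le_numLayers (2 ^ e)
  have hmem : chosenArm R oracle δ obs e t ∈ (traversal R oracle δ obs e t).2 :=
    R.pick_mem _ _ _ _ a1
  have hadd : 1 + (numLayers (2 ^ e) - 1) = numLayers (2 ^ e) := by omega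
  rw [hadd] at a4 a5
  refine ⟨?_, hmem, a2 hmem, a3, a4, fun hlt => a5 hlt _ hmem⟩
  rw [decision_eq R oracle δ obs h1 h2, if_pos h]

theorem decision_of_empty {e t : ℕ} (h1 : 2 ^ e ≤ t) (h2 : t < 2 ^ (e + 1))
    (h : ¬ (candidates oracle δ obs B e t).Nonempty) :
    decision R oracle δ obs t = ⟨0, 0, R.fallback t (fun i => obs i) (obs t).1⟩ := by
  rw [decision_eq R oracle δ obs h1 h2, if_neg h]

theorem exists_episode {t : ℕ} (ht : t ≠ 0) : ∃ e, 2 ^ e ≤ t ∧ t < 2 ^ (e + 1) :=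
  ⟨Nat.log 2 t, Nat.pow_log_le_self 2 ht, Nat.lt_pow_succ_log_self (by norm_num) t⟩

theorem decision_price_mem (hB : 0 ≤ B) (t : ℕ) :
    (decision R oracle δ obs t).price ∈ Set.Icc 0 B := by
  rcases eq_or_ne t 0 with rfl | ht
  · rw [decision_zero]; exact R.fallback_mem _ _ _
  · obtain ⟨e, h1, h2⟩ := exists_episode ht
    by_cases h : (candidates oracle δ obs B e t).Nonempty
    · obtain ⟨hd, -, hc, -⟩ := decision_of_nonempty R oracle δ obs hB h1 h2 h
      rw [hd]
      have := (Finset.mem_filter.1 hc).2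
      exact ⟨this.1.le, this.2.le⟩
    · rw [decision_of_empty R oracle δ obs h1 h2 h]; exact R.fallback_mem _ _ _

theorem decision_of_layer_ne_zero (hB : 0 ≤ B) {e t : ℕ} (h1 : 2 ^ e ≤ t) (h2 : t < 2 ^ (e + 1))
    (h : (decision R oracle δ obs t).layer ≠ 0) :
    (decision R oracle δ obs t).layer ∈ Finset.Icc 1 (numLayers (2 ^ e)) ∧
    (decision R oracle δ obs t).arm ∈ candidates oracle δ obs B e t ∧
    (decision R oracle δ obs t).price =
      armPrice oracle δ obs B e t (decision R oracle δ obs t).arm ∧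
    ((decision R oracle δ obs t).layer < numLayers (2 ^ e) →
      B / 2 ^ (decision R oracle δ obs t).layer < (decision R oracle δ obs t).price *
        armRadius R oracle δ obs e t (decision R oracle δ obs t).layer
          (decision R oracle δ obs t).arm) := by
  by_cases hc : (candidates oracle δ obs B e t).Nonempty
  · obtain ⟨hd, -, h3, h4, h5, h6⟩ := decision_of_nonempty R oracle δ obs hB h1 h2 hc
    rw [hd]
    exact ⟨Finset.mem_Icc.2 ⟨h4, h5⟩, h3, rfl, h6⟩
  · rw [decision_of_empty R oracle δ obs h1 h2 hc] at h
    exact absurd rfl h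

/-- The logarithmic factor in the confidence radii of an episode of length `T`. -/
noncomputable def logFactor (δ : ℝ) (T : ℕ) : ℝ :=
  Real.log (2 * (numLayers T) * (numGrid T) * T / δ)

theorem logFactor_ge_one {δ : ℝ} {T : ℕ} (hT : 0 < T) (hδ : 0 < δ) (hδ2 : δ ≤ 1 / 2) :
    1 ≤ logFactor δ T := by
  have h1 : (1 : ℝ) ≤ numLayers T := by exact_mod_cast one_le_numLayers T
  have h2 : (1 : ℝ) ≤ numGrid T := by exact_mod_cast numGrid_pos hT
  have h3 : (1 : ℝ) ≤ T := by exact_mod_cast hT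
  have h12 : (1 : ℝ) ≤ numLayers T * numGrid T := one_le_mul_of_one_le_of_one_le h1 h2
  have h123 : (1 : ℝ) ≤ numLayers T * numGrid T * T := one_le_mul_of_one_le_of_one_le h12 h3
  rw [logFactor, Real.le_log_iff_exp_le (by positivity), le_div_iff₀ hδ]
  have := Real.exp_one_lt_d9
  nlinarith [Real.exp_pos 1]

theorem lt_of_lt_radius {δ : ℝ} {S N T n s : ℕ}
    (h : 1 / 2 ^ s < radius δ S N T n) (hΛ : 0 ≤ Real.log (2 * S * N * T / δ)) :
    (n : ℝ) ≤ 2 * 4 ^ s * Real.log (2 * S * N * T / δ) := by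
  unfold radius at h
  split_ifs at h with hn
  · rw [hn]; push_cast; positivity
  · have hn' : (0 : ℝ) < n := by exact_mod_cast Nat.pos_of_ne_zero hn
    have h1 := (lt_min_iff.1 h).1
    have h2 := (Real.lt_sqrt (by positivity)).1 h1
    rw [lt_div_iff₀ hn', div_pow, one_pow, ← pow_mul, mul_comm s 2, pow_mul] at h2
    norm_num at h2
    have h4 : (0 : ℝ) < 4 ^ s := by positivity
    rw [inv_mul_lt_iff₀ h4] at h2
    linarith

/-- An index stops only logarithmically often in a layer before the last one. -/
theorem card_stopRounds_le (hB : 0 < B) (hδ : 0 < δ) (hδ2 : δ ≤ 1 / 2) {e s : ℕ} (j : ℕ)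
    (hs1 : 1 ≤ s) (hs : s < numLayers (2 ^ e)) :
    ((stopRounds R oracle δ obs (2 ^ e) (2 ^ (e + 1)) s j).card : ℝ) ≤
      3 * 4 ^ s * logFactor δ (2 ^ e) := by
  have hΛ := logFactor_ge_one (T := 2 ^ e) (by positivity) hδ hδ2
  have h4 : (1 : ℝ) ≤ 4 ^ s := one_le_pow₀ (by norm_num)
  rcases (stopRounds R oracle δ obs (2 ^ e) (2 ^ (e + 1)) s j).eq_empty_or_nonempty with h | h
  · rw [h]; simp only [Finset.card_empty, Nat.cast_zero]; positivity
  -- At the last stop `t` the precision check failed, and prices are at most `B`, so the radius from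
  -- the earlier stops exceeds `2^{-s}`. This bounds their number by `2 · 4^s` times the logarithmic
  -- factor. The stop at `t` itself turns the `2` into a `3`.
  · have hm := Finset.max'_mem _ h
    set t := (stopRounds R oracle δ obs (2 ^ e) (2 ^ (e + 1)) s j).max' h with ht
    obtain ⟨htI, hts, htj⟩ := Finset.mem_filter.1 hm
    obtain ⟨h1, h2⟩ := Finset.mem_Ico.1 htI
    have hsub : stopRounds R oracle δ obs (2 ^ e) (2 ^ (e + 1)) s j ⊆
        insert t (stopRounds R oracle δ obs (2 ^ e) t s j) := by
      intro τ hτ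
      have hle : τ ≤ t := Finset.le_max' _ _ hτ
      obtain ⟨hτI, hτ2⟩ := Finset.mem_filter.1 hτ
      rcases hle.eq_or_lt with heq | hlt
      · exact heq ▸ Finset.mem_insert_self _ _
      · exact Finset.mem_insert_of_mem (Finset.mem_filter.2
          ⟨Finset.mem_Ico.2 ⟨(Finset.mem_Ico.1 hτI).1, hlt⟩, hτ2⟩)
    have hcard : ((stopRounds R oracle δ obs (2 ^ e) (2 ^ (e + 1)) s j).card : ℝ) ≤
        (stopRounds R oracle δ obs (2 ^ e) t s j).card + 1 := by
      exact_mod_cast (Finset.card_le_card hsub).trans (Finset.card_insert_le _ _)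
    obtain ⟨-, h4', h5, h6⟩ := decision_of_layer_ne_zero R oracle δ obs hB.le h1 h2
      (by rw [hts]; omega)
    rw [hts, htj] at h6
    have h7 := h6 hs
    have hp := (decision_price_mem R oracle δ obs hB.le t)
    have hr : 1 / 2 ^ s < armRadius R oracle δ obs e t s j := by
      by_contra hle
      have : (decision R oracle δ obs t).price * armRadius R oracle δ obs e t s j ≤
          B * (1 / 2 ^ s) :=
        mul_le_mul_of_nonneg hp.2 (not_lt.1 hle) hp.1 (by positivity)
      rw [mul_one_div] at this
      linarith
    have := lt_of_lt_radius hr (by unfold logFactor at hΛ; linarith)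
    unfold logFactor at hΛ ⊢
    nlinarith

end Episode


/-! ### Regret of an episode on the concentration event -/

theorem supNorm_le {X : Type*} {f : X → ℝ} {b : ℝ} (hb : 0 ≤ b) (h : ∀ x, |f x| ≤ b) :
    supNorm f ≤ b := Real.iSup_le h hb

theorem abs_le_supNorm {X : Type*} {f : X → ℝ} {b : ℝ} (h : ∀ x, |f x| ≤ b) (x : X) :
    |f x| ≤ supNorm f :=
  le_ciSup (f := fun x => |f x|) ⟨b, by rintro _ ⟨y, rfl⟩; exact h y⟩ x

theorem sale_mem (v p : ℝ) : sale v p ∈ Set.Icc (0 : ℝ) 1 := by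
  unfold sale; split_ifs <;> simp

theorem numLayers_two_pow (e : ℕ) : numLayers (2 ^ e) = max 1 ⌈(e : ℝ) / 2⌉₊ := by
  rw [numLayers]
  congr 3
  push_cast
  rw [Real.logb_pow, Real.logb_self_eq_one (by norm_num), mul_one]

theorem numLayers_two_pow_le (e : ℕ) : numLayers (2 ^ e) ≤ e + 1 := by
  rw [numLayers_two_pow]
  refine max_le (by omega) (Nat.ceil_le.2 ?_)
  have : (0 : ℝ) ≤ e := e.cast_nonneg
  push_cast; linarith

/-- The reason for the number of layers: at the last one the resolution `2^{-S}` is at most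
`T^{-1/2}`, so even `T` stops there cost only order `√T`. No count of stops is available in that
layer. -/
theorem two_pow_le_four_pow_numLayers (e : ℕ) : (2 : ℝ) ^ e ≤ 4 ^ numLayers (2 ^ e) := by
  have h1 : (e : ℝ) / 2 ≤ numLayers (2 ^ e) := by
    rw [numLayers_two_pow]
    exact (Nat.le_ceil _).trans (by exact_mod_cast le_max_right _ _)
  have h2 : e ≤ 2 * numLayers (2 ^ e) := by
    have : (e : ℝ) ≤ 2 * numLayers (2 ^ e) := by linarith
    exact_mod_cast this
  calc (2 : ℝ) ^ e ≤ 2 ^ (2 * numLayers (2 ^ e)) := pow_le_pow_right₀ (by norm_num) h2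
    _ = 4 ^ numLayers (2 ^ e) := by rw [pow_mul]; norm_num

section Episode

variable {X : Type*} [MeasurableSpace X] {B : ℝ} (R : SelectionRule X B) (oracle : Oracle X)
  (δ : ℝ) (obs : ℕ → X × ℝ)

/-- The expected demand at index `t` given the past and the context. -/
noncomputable def demand (F : ℝ → ℝ) (vstar : X → ℝ) (t : ℕ) : ℝ :=
  1 - F ((decision R oracle δ obs t).price - vstar (obs t).1)

/-- The deviation of the sale outcomes from the expected demand, summed over the rounds of episode
`e` before index `t` that stopped in layer `s` with index `j`. -/
noncomputable def deviation (F : ℝ → ℝ) (vstar : X → ℝ) (e t s j : ℕ) : ℝ :=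
  ∑ τ ∈ stopRounds R oracle δ obs (2 ^ e) t s j,
    (sale (obs τ).2 (decision R oracle δ obs τ).price - demand R oracle δ obs F vstar τ)

/-- The sale outcomes of episode `e` concentrate, for all layers and indices. -/
def Concentrates (F : ℝ → ℝ) (vstar : X → ℝ) (e : ℕ) : Prop :=
  ∀ t ∈ Finset.Ico (2 ^ e) (2 ^ (e + 1)), ∀ s ∈ Finset.Icc 1 (numLayers (2 ^ e)),
    ∀ j ∈ Finset.Icc 1 (numGrid (2 ^ e)),
      0 < (stopRounds R oracle δ obs (2 ^ e) t s j).card →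
      |deviation R oracle δ obs F vstar e t s j| ≤
        (stopRounds R oracle δ obs (2 ^ e) t s j).card *
          √(2 * logFactor δ (2 ^ e) / (stopRounds R oracle δ obs (2 ^ e) t s j).card)

variable {F : ℝ → ℝ} {vstar pstar : X → ℝ} {L C ε : ℝ}

/-- The samples come from rounds with other contexts. The noise in them is controlled by the
concentration event, and the drift of the demand by the estimation error, which enters once for each
of the two contexts. -/
theorem abs_armMean_sub_le (hB : 0 ≤ B) (hF : ∀ u, F u ∈ Set.Icc (0 : ℝ) 1)
    (hL : 0 ≤ L) (hFL : ∀ u w, |F u - F w| ≤ L * |u - w|) {e t s j : ℕ}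
    (ht : t ∈ Finset.Ico (2 ^ e) (2 ^ (e + 1))) (hs : s ∈ Finset.Icc 1 (numLayers (2 ^ e)))
    (hj : j ∈ Finset.Icc 1 (numGrid (2 ^ e)))
    (hε : ∀ z, |estimator oracle δ obs e z - vstar z| ≤ ε)
    (hgood : Concentrates R oracle δ obs F vstar e) :
    |armMean R oracle δ obs e t s j - (1 - F (armPrice oracle δ obs B e t j - vstar (obs t).1))| ≤
      armRadius R oracle δ obs e t s j + 2 * L * ε := by
  have hε0 : 0 ≤ ε := (abs_nonneg _).trans (hε (obs t).1)
  have hLε : 0 ≤ 2 * L * ε := by positivity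
  set D := 1 - F (armPrice oracle δ obs B e t j - vstar (obs t).1) with hD
  have hD01 : 0 ≤ D ∧ D ≤ 1 := by
    have := hF (armPrice oracle δ obs B e t j - vstar (obs t).1)
    exact ⟨by linarith [this.2], by linarith [this.1]⟩
  set P := stopRounds R oracle δ obs (2 ^ e) t s j with hP
  have hconc := hgood t ht s hs j hj
  rw [← hP] at hconc
  unfold armMean armRadius radius
  rw [← hP]
  split_ifs with hn
  · rw [hn]; simp only [Nat.cast_zero, div_zero, zero_sub, abs_neg]
    rw [abs_of_nonneg hD01.1]; linarith
  · have hn0 : 0 < P.card := Nat.pos_of_ne_zero hn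
    have hn' : (0 : ℝ) < P.card := by exact_mod_cast hn0
    have hsum0 : 0 ≤ ∑ τ ∈ P, sale (obs τ).2 (decision R oracle δ obs τ).price :=
      Finset.sum_nonneg fun τ _ => (sale_mem _ _).1
    have hsum1 : ∑ τ ∈ P, sale (obs τ).2 (decision R oracle δ obs τ).price ≤ P.card := by
      have := Finset.sum_le_card_nsmul P
        (fun τ => sale (obs τ).2 (decision R oracle δ obs τ).price) 1
        (fun τ _ => (sale_mem _ _).2)
      simpa using this
    have hw0 := div_nonneg hsum0 hn'.le
    have hw1 := (div_le_one hn').2 hsum1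
    -- Both quantities lie in `[0, 1]`, which justifies truncating the radius at `1`.
    have hle1 : |(∑ τ ∈ P, sale (obs τ).2 (decision R oracle δ obs τ).price) / P.card - D| ≤ 1 :=
      abs_le.2 ⟨by linarith, by linarith⟩
    rw [← min_add_add_right]
    refine le_min ?_ (by linarith)
    have hdiff : ∀ τ ∈ P, |demand R oracle δ obs F vstar τ - D| ≤ 2 * L * ε := by
      intro τ hτ
      obtain ⟨hτI, hτs, hτj⟩ := Finset.mem_filter.1 hτ
      have hτI := Finset.mem_Ico.1 hτI
      obtain ⟨-, -, hp, -⟩ := decision_of_layer_ne_zero R oracle δ obs hB hτI.1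
        (hτI.2.trans (Finset.mem_Ico.1 ht).2)
        (by rw [hτs]; exact Nat.one_le_iff_ne_zero.1 (Finset.mem_Icc.1 hs).1)
      rw [hτj] at hp
      have h1 := abs_le.1 (hε (obs τ).1)
      have h2 := abs_le.1 (hε (obs t).1)
      rw [demand, hD, sub_sub_sub_cancel_left]
      refine (hFL _ _).trans ?_
      rw [hp, armPrice, armPrice, mul_comm 2 L, mul_assoc]
      refine mul_le_mul_of_nonneg_left (abs_le.2 ⟨by linarith, by linarith⟩) hL
    have hsplit : (∑ τ ∈ P, sale (obs τ).2 (decision R oracle δ obs τ).price) / P.card - D =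
        (deviation R oracle δ obs F vstar e t s j +
          ∑ τ ∈ P, (demand R oracle δ obs F vstar τ - D)) / P.card := by
      rw [deviation, ← hP, ← Finset.sum_add_distrib]
      simp only [sub_add_sub_cancel]
      rw [Finset.sum_sub_distrib, Finset.sum_const, nsmul_eq_mul]
      field_simp
    rw [hsplit, abs_div, abs_of_pos hn', div_le_iff₀ hn']
    refine (abs_add_le _ _).trans ?_
    have h2 : |∑ τ ∈ P, (demand R oracle δ obs F vstar τ - D)| ≤ P.card * (2 * L * ε) := by
      refine (Finset.abs_sum_le_sum_abs _ _).trans ?_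
      refine (Finset.sum_le_card_nsmul _ _ _ hdiff).trans ?_
      rw [nsmul_eq_mul]
    have h1 := hconc hn0
    unfold logFactor at h1
    linarith

theorem rev_le_of_nonneg (hF : ∀ u, F u ∈ Set.Icc (0 : ℝ) 1) {q p : ℝ} (hp : 0 ≤ p) :
    rev F q p ∈ Set.Icc 0 p := by
  have h := hF (p - q)
  unfold rev
  exact ⟨mul_nonneg hp (by linarith [h.2]), mul_le_of_le_one_right hp (by linarith [h.1])⟩

theorem ucb_bounds {B p w r D k : ℝ} (hp : 0 ≤ p) (hpB : p ≤ B) (hk : 0 ≤ k)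
    (h : |w - D| ≤ r + k) :
    p * D - B * k ≤ p * (w + r) ∧ p * (w + r) ≤ p * D + 2 * (p * r) + B * k := by
  obtain ⟨h1, h2⟩ := abs_le.1 h
  have h3 : 0 ≤ p * (w + r - D + k) := mul_nonneg hp (by linarith)
  have h4 : 0 ≤ p * (r + k - (w - D)) := mul_nonneg hp (by linarith)
  have h5 := mul_le_mul_of_nonneg_right hpB hk
  constructor <;> linarith

/-- Per-round regret in an episode: resolution of the layer, estimation error, discretization. -/
theorem round_regret_le (hB : 0 < B) (hL : 0 ≤ L) (hC : 0 ≤ C)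
    (hF : ∀ u, F u ∈ Set.Icc (0 : ℝ) 1) (hFL : ∀ u w, |F u - F w| ≤ L * |u - w|)
    {Bε : ℝ} (hFB : ∀ u, Bε ≤ u → F u = 1) (hBε : 0 ≤ Bε)
    (hv : ∀ z, vstar z ∈ Set.Icc Bε (B - Bε)) (hp0 : ∀ z, 0 ≤ pstar z)
    (hsmooth : ∀ z p, 0 ≤ p →
      rev F (vstar z) (pstar z) - rev F (vstar z) p ≤ C * (pstar z - p) ^ 2)
    {e t : ℕ} (ht : t ∈ Finset.Ico (2 ^ e) (2 ^ (e + 1)))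
    (hε : ∀ z, |estimator oracle δ obs e z - vstar z| ≤ ε)
    (hgood : Concentrates R oracle δ obs F vstar e) :
    rev F (vstar (obs t).1) (pstar (obs t).1) -
        rev F (vstar (obs t).1) (decision R oracle δ obs t).price ≤
      (if (decision R oracle δ obs t).layer = 0 then 0
        else 8 * B / 2 ^ (decision R oracle δ obs t).layer) +
      (4 * L * B * numLayers (2 ^ e) + 1) * ε +
      (9 / 4 * C + 4 / B) * (5 * B / numGrid (2 ^ e)) ^ 2 := by
  have hε0 : 0 ≤ ε := (abs_nonneg _).trans (hε (obs t).1)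
  have ht' := Finset.mem_Ico.1 ht
  have hprice := decision_price_mem R oracle δ obs hB.le t
  have hrev0 := (rev_le_of_nonneg hF (q := vstar (obs t).1) hprice.1).1
  have hNpos : 0 < numGrid (2 ^ e) := numGrid_pos (by positivity)
  have hN' : (0 : ℝ) < numGrid (2 ^ e) := by exact_mod_cast hNpos
  have hterm1 : 0 ≤ (if (decision R oracle δ obs t).layer = 0 then 0
        else 8 * B / 2 ^ (decision R oracle δ obs t).layer) := by
    split_ifs <;> positivity
  have hterm2 : ε ≤ (4 * L * B * numLayers (2 ^ e) + 1) * ε :=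
    le_mul_of_one_le_left hε0 (by linarith [show 0 ≤ 4 * L * B * numLayers (2 ^ e) by positivity])
  have hterm3 : 0 ≤ (9 / 4 * C + 4 / B) * (5 * B / numGrid (2 ^ e)) ^ 2 := by positivity
  set x := (obs t).1 with hx
  rcases le_or_gt (rev F (vstar x) (pstar x)) 0 with hneg | hpos
  · linarith
  -- A price of at least `B` exceeds every possible valuation and earns nothing.
  have hpB : pstar x < B := by
    by_contra hge
    have h1 : F (pstar x - vstar x) = 1 := hFB _ (by linarith [(hv x).2, not_lt.1 hge])
    rw [rev, h1] at hpos
    simp at hpos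
  have hregB : rev F (vstar x) (pstar x) ≤ B :=
    (rev_le_of_nonneg hF (hp0 x)).2.trans hpB.le
  -- The regret of a round is at most `B`. An error above `B` thus pays for it through the `+ 1` in
  -- the coefficient of `ε`; otherwise `|v̂| ≤ 2B`, so the supremum norm is genuine and the grid
  -- interval has length at most `5B`.
  rcases lt_or_ge B ε with hBε' | hεB
  · linarith
  have hvB : ∀ z, |vstar z| ≤ B := fun z => abs_le.2 ⟨by linarith [(hv z).1], by linarith [(hv z).2]⟩
  have hhat : ∀ z, |estimator oracle δ obs e z| ≤ 2 * B := by
    intro z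
    have h1 := abs_le.1 (hε z)
    have h2 := abs_le.1 (hvB z)
    exact abs_le.2 ⟨by linarith, by linarith⟩
  have hV2 := supNorm_le (by linarith) hhat
  have hVx := abs_le_supNorm hhat x
  set V := supNorm (estimator oracle δ obs e) with hV
  have hV0 : 0 ≤ V := (abs_nonneg _).trans hVx
  set h := (B + 2 * V) / numGrid (2 ^ e) with hh
  have hh0 : 0 < h := by positivity
  have hh5 : h ≤ 5 * B / numGrid (2 ^ e) := by
    rw [hh]; gcongr; linarith
  have hsq : h ^ 2 ≤ (5 * B / numGrid (2 ^ e)) ^ 2 := by gcongr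
  have hdisc : 9 / 4 * C * h ^ 2 + 4 / B * h ^ 2 ≤
      (9 / 4 * C + 4 / B) * (5 * B / numGrid (2 ^ e)) ^ 2 := by
    rw [← add_mul]; gcongr
  have hCh : 0 ≤ 9 / 4 * C * h ^ 2 := by positivity
  have hBh : 0 ≤ 4 / B * h ^ 2 := by positivity
  -- Where `4 / B` comes from: on a grid this coarse, `4 / B * h ^ 2` already exceeds `B`.
  rcases lt_or_ge (B / 2) h with hlarge | hsmall
  · have : B ≤ 4 / B * h ^ 2 := by
      rw [div_mul_eq_mul_div, le_div_iff₀ hB]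
      nlinarith
    linarith
  obtain ⟨j, hjN, hj1, hj2, hj3⟩ := exists_grid_price_near hNpos hh hB hVx
    ⟨hp0 x, hpB.le⟩ hsmall
  have hjc : j ∈ candidates oracle δ obs B e t := Finset.mem_filter.2 ⟨hjN, hj1, hj2⟩
  obtain ⟨hd, hmem, hcand, hl1, hlS, -⟩ :=
    decision_of_nonempty R oracle δ obs hB.le ht'.1 ht'.2 ⟨j, hjc⟩
  have hη : 0 ≤ 2 * L * B * ε := by positivity
  have hLε : 0 ≤ 2 * L * ε := by positivity
  have hdem := fun s (hs : s ≤ numLayers (2 ^ e)) (hs1 : 1 ≤ s) j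
    (hj : j ∈ candidates oracle δ obs B e t) =>
      abs_armMean_sub_le R oracle δ obs hB.le hF hL hFL ht (Finset.mem_Icc.2 ⟨hs1, hs⟩)
        (Finset.mem_filter.1 hj).1 hε hgood
  rw [← hx] at hdem
  have hS := one_le_numLayers (2 ^ e)
  have hvj : ∀ j ∈ candidates oracle δ obs B e t,
      rev F (vstar x) (armPrice oracle δ obs B e t j) ∈ Set.Icc 0 B := by
    intro j hj
    have h1 := (Finset.mem_filter.1 hj).2
    have h2 := rev_le_of_nonneg hF (q := vstar x) h1.1.le
    exact ⟨h2.1, h2.2.trans h1.2.le⟩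
  -- The benchmark is the grid price near the optimum. The misspecification is `2LBε`, the demand
  -- error times the largest price. In layer 1 the allowance `8B/2 = 4B` is trivially enough.
  have hval := layerTraversal_value (M := rev F (vstar x) (armPrice oracle δ obs B e t j))
    (fun s j => armPrice oracle δ obs B e t j * armRadius R oracle δ obs e t s j)
    (fun s j => armPrice oracle δ obs B e t j *
      (armMean R oracle δ obs e t s j + armRadius R oracle δ obs e t s j))
    (fun j => rev F (vstar x) (armPrice oracle δ obs B e t j)) (numLayers (2 ^ e)) hB.le hη
    (candidates oracle δ obs B e t) ?_ ?_ (numLayers (2 ^ e) - 1) 1 _ (Finset.Subset.refl _)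
    le_rfl (by omega) ⟨j, hjc, ?_⟩ ?_ _ hmem
  · rw [← traversal] at hval
    have hM := hsmooth x (armPrice oracle δ obs B e t j) hj1.le
    have hsq2 : (pstar x - armPrice oracle δ obs B e t j) ^ 2 ≤ (3 / 2 * h) ^ 2 :=
      sq_le_sq.2 (by rw [abs_of_pos (by positivity : 0 < 3 / 2 * h)]; exact hj3)
    have hM2 := mul_le_mul_of_nonneg_left hsq2 hC
    have hlS' : ((traversal R oracle δ obs e t).1 : ℝ) ≤ numLayers (2 ^ e) := by
      exact_mod_cast hlS
    have h8 := mul_le_mul_of_nonneg_left hlS' hη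
    rw [hd]
    simp only
    rw [if_neg (by omega)]
    linarith
  · intro s hs hs1 j hj
    have h2 := (Finset.mem_filter.1 hj).2
    have := (ucb_bounds h2.1.le h2.2.le hLε (hdem s hs hs1 j hj)).1
    simp only [rev]
    linarith
  · intro s hs hs1 j hj
    have h2 := (Finset.mem_filter.1 hj).2
    have := (ucb_bounds h2.1.le h2.2.le hLε (hdem s hs hs1 j hj)).2
    simp only [rev]
    linarith
  · simp only [Nat.cast_one]; linarith
  · intro i hi
    have h1 := hvj i hi
    have h2 := hvj j hjc
    simp only [Nat.cast_one, pow_one]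
    linarith [h1.1, h2.2]

/-- The total resolution of the layers in which the rounds of an episode stop. -/
theorem sum_layer_resolution_le (hB : 0 < B) (hδ : 0 < δ) (hδ2 : δ ≤ 1 / 2) (e : ℕ) :
    ∑ t ∈ Finset.Ico (2 ^ e) (2 ^ (e + 1)), (if (decision R oracle δ obs t).layer = 0 then 0
        else 8 * B / 2 ^ (decision R oracle δ obs t).layer) ≤
      numLayers (2 ^ e) * (8 * B * √(3 * numGrid (2 ^ e) * 2 ^ e * logFactor δ (2 ^ e))) := by
  set S := numLayers (2 ^ e) with hS
  set N := numGrid (2 ^ e) with hN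
  set Λ := logFactor δ (2 ^ e) with hΛdef
  have hΛ : 1 ≤ Λ := logFactor_ge_one (T := 2 ^ e) (by positivity) hδ hδ2
  have hNpos : 0 < N := numGrid_pos (by positivity)
  have hN1 : (1 : ℝ) ≤ N := by exact_mod_cast hNpos
  set I := Finset.Ico (2 ^ e) (2 ^ (e + 1)) with hI
  have hIcard : (I.card : ℝ) = 2 ^ e := by
    rw [hI, Nat.card_Ico, pow_succ, mul_two, Nat.add_sub_cancel]; push_cast; rfl
  have hmaps : ∀ t ∈ I, (decision R oracle δ obs t).layer ∈ Finset.range (S + 1) := by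
    intro t ht
    have ht' := Finset.mem_Ico.1 ht
    by_cases h : (decision R oracle δ obs t).layer = 0
    · rw [h]; simp
    · have := (decision_of_layer_ne_zero R oracle δ obs hB.le ht'.1 ht'.2 h).1
      exact Finset.mem_range.2 (by have := (Finset.mem_Icc.1 this).2; omega)
  rw [← Finset.sum_fiberwise_of_maps_to hmaps]
  have hfib : ∀ s ∈ Finset.range (S + 1),
      ∑ t ∈ I with (decision R oracle δ obs t).layer = s,
        (if (decision R oracle δ obs t).layer = 0 then 0
        else 8 * B / 2 ^ (decision R oracle δ obs t).layer) =
      if s = 0 then 0 else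
        ((I.filter (fun t => (decision R oracle δ obs t).layer = s)).card : ℝ) *
          (8 * B / 2 ^ s) := by
    intro s _
    rw [Finset.sum_congr rfl (g := fun _ => if s = 0 then 0 else 8 * B / 2 ^ s)
      (fun t ht => by rw [(Finset.mem_filter.1 ht).2])]
    rw [Finset.sum_const, nsmul_eq_mul]
    split_ifs <;> simp
  rw [Finset.sum_congr rfl hfib, Finset.sum_range_succ']
  simp only [if_true, add_zero, Nat.add_eq_zero_iff, one_ne_zero, and_false, if_false]
  refine (Finset.sum_le_card_nsmul _ _
    (8 * B * √(3 * N * 2 ^ e * Λ)) ?_).trans (by simp)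
  intro s' hs'
  have hsS : s' + 1 ≤ S := by have := Finset.mem_range.1 hs'; omega
  set s := s' + 1 with hsdef
  set P := I.filter (fun t => (decision R oracle δ obs t).layer = s) with hPdef
  have hPT : (P.card : ℝ) ≤ 2 ^ e := by
    rw [← hIcard]; exact_mod_cast Finset.card_filter_le _ _
  have h2s : (0 : ℝ) < 2 ^ s := by positivity
  have h4s : ((2 : ℝ) ^ s) ^ 2 = 4 ^ s := by rw [← pow_mul, mul_comm, pow_mul]; norm_num
  -- The geometric mean of two bounds on the count: the episode length, and the stops per index
  -- summed over the indices. In the last layer the episode length serves twice, since `2^e ≤ 4^s`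
  -- there.
  have hmain : (P.card : ℝ) ≤ 2 ^ s * √(3 * N * 2 ^ e * Λ) := by
    have hsq : (P.card : ℝ) ^ 2 ≤ 4 ^ s * (3 * N * 2 ^ e * Λ) := by
      rcases hsS.eq_or_lt with hlast | hlt
      · have h1 : (2 : ℝ) ^ e ≤ 4 ^ s := by rw [hlast]; exact two_pow_le_four_pow_numLayers e
        have h2 : (1 : ℝ) ≤ 3 * N * Λ := by nlinarith
        calc (P.card : ℝ) ^ 2 ≤ (2 ^ e) ^ 2 := by gcongr
          _ = 2 ^ e * 2 ^ e := sq _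
          _ ≤ 4 ^ s * (2 ^ e * (3 * N * Λ)) := by
            gcongr; exact le_mul_of_one_le_right (by positivity) h2
          _ = _ := by ring
      · have hsum : (P.card : ℝ) ≤ N * (3 * 4 ^ s * Λ) := by
          have hm : ∀ t ∈ P, (decision R oracle δ obs t).arm ∈ Finset.Icc 1 N := by
            intro t ht
            obtain ⟨htI, hts⟩ := Finset.mem_filter.1 ht
            have ht' := Finset.mem_Ico.1 htI
            have := (decision_of_layer_ne_zero R oracle δ obs hB.le ht'.1 ht'.2
              (by rw [hts]; omega)).2.1
            exact (Finset.mem_filter.1 this).1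
          rw [Finset.card_eq_sum_card_fiberwise hm]
          push_cast
          refine (Finset.sum_le_card_nsmul _ _ (3 * 4 ^ s * Λ) fun j _ => ?_).trans (by simp)
          have := card_stopRounds_le R oracle δ obs hB hδ hδ2 j (s := s) (by omega) hlt
          rw [stopRounds] at this
          rw [hPdef, Finset.filter_filter]
          exact this
        calc (P.card : ℝ) ^ 2 = P.card * P.card := sq _
          _ ≤ 2 ^ e * (N * (3 * 4 ^ s * Λ)) := by gcongr
          _ = _ := by ring
    have := Real.le_sqrt_of_sq_le hsq
    rwa [Real.sqrt_mul (by positivity), ← h4s, Real.sqrt_sq h2s.le] at this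
  calc (P.card : ℝ) * (8 * B / 2 ^ s)
      ≤ 2 ^ s * √(3 * N * 2 ^ e * Λ) * (8 * B / 2 ^ s) := by gcongr
    _ = 8 * B * √(3 * N * 2 ^ e * Λ) := by field_simp

theorem episode_regret_le (hB : 0 < B) (hL : 0 ≤ L) (hC : 0 ≤ C)
    (hF : ∀ u, F u ∈ Set.Icc (0 : ℝ) 1) (hFL : ∀ u w, |F u - F w| ≤ L * |u - w|)
    {Bε : ℝ} (hFB : ∀ u, Bε ≤ u → F u = 1) (hBε : 0 ≤ Bε)
    (hv : ∀ z, vstar z ∈ Set.Icc Bε (B - Bε)) (hp0 : ∀ z, 0 ≤ pstar z)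
    (hsmooth : ∀ z p, 0 ≤ p →
      rev F (vstar z) (pstar z) - rev F (vstar z) p ≤ C * (pstar z - p) ^ 2)
    (hδ : 0 < δ) (hδ2 : δ ≤ 1 / 2) {e : ℕ}
    (hε : ∀ z, |estimator oracle δ obs e z - vstar z| ≤ ε)
    (hgood : Concentrates R oracle δ obs F vstar e) :
    ∑ t ∈ Finset.Ico (2 ^ e) (2 ^ (e + 1)), (rev F (vstar (obs t).1) (pstar (obs t).1) -
        rev F (vstar (obs t).1) (decision R oracle δ obs t).price) ≤
      numLayers (2 ^ e) * (8 * B * √(3 * numGrid (2 ^ e) * 2 ^ e * logFactor δ (2 ^ e))) +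
      (4 * L * B * numLayers (2 ^ e) + 1) * (2 ^ e * ε) +
      (9 / 4 * C + 4 / B) * (2 ^ e * (5 * B / numGrid (2 ^ e)) ^ 2) := by
  have hIcard : ((Finset.Ico (2 ^ e) (2 ^ (e + 1))).card : ℝ) = 2 ^ e := by
    rw [Nat.card_Ico, pow_succ, mul_two, Nat.add_sub_cancel]; push_cast; rfl
  refine (Finset.sum_le_sum fun t ht => round_regret_le R oracle δ obs hB hL hC hF hFL hFB hBε hv
    hp0 hsmooth ht hε hgood).trans ?_
  rw [Finset.sum_add_distrib, Finset.sum_add_distrib, Finset.sum_const, Finset.sum_const,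
    nsmul_eq_mul, nsmul_eq_mul, hIcard]
  have := sum_layer_resolution_le R oracle δ obs hB hδ hδ2 e
  linarith

end Episode


/-! ### The decisions depend measurably on the past -/

section Traversal

variable {α : Type*} [MeasurableSpace α]

theorem measurable_apply_index {f : ℕ → α → ℝ} (hf : ∀ j, Measurable (f j)) {k : α → ℕ}
    (hk : Measurable k) : Measurable (fun o => f (k o) o) := by
  have : Measurable (fun q : ℕ × α => f q.1 q.2) := measurable_from_prod_countable_right hf
  exact this.comp (hk.prodMk measurable_id)

/-- A random finite set of indices is measurable. -/
def MeasurableIndexSet (A : α → Finset ℕ) : Prop := ∀ j, MeasurableSet {o | j ∈ A o}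

theorem MeasurableIndexSet.measurableSet_eq {A : α → Finset ℕ} (hA : MeasurableIndexSet A)
    (A₀ : Finset ℕ) : MeasurableSet {o | A o = A₀} := by
  have : {o | A o = A₀} = ⋂ j, {o | j ∈ A o ↔ j ∈ A₀} := by
    ext o; simp [Finset.ext_iff]
  rw [this]
  refine MeasurableSet.iInter fun j => ?_
  by_cases h : j ∈ A₀
  · simp only [h, iff_true]; exact hA j
  · simp only [h, iff_false]; exact (hA j).compl

theorem MeasurableIndexSet.measurableSet_nonempty {A : α → Finset ℕ} (hA : MeasurableIndexSet A) :
    MeasurableSet {o | (A o).Nonempty} := by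
  have : {o | (A o).Nonempty} = ⋃ j, {o | j ∈ A o} := by
    ext o; simp [Finset.Nonempty]
  rw [this]
  exact MeasurableSet.iUnion hA

theorem MeasurableIndexSet.ite {A A' : α → Finset ℕ} (hA : MeasurableIndexSet A)
    (hA' : MeasurableIndexSet A') {p : α → Prop} [DecidablePred p] (hp : MeasurableSet {o | p o}) :
    MeasurableIndexSet (fun o => if p o then A o else A' o) := by
  intro j
  have : {o | j ∈ if p o then A o else A' o} =
      ({o | p o} ∩ {o | j ∈ A o}) ∪ ({o | p o}ᶜ ∩ {o | j ∈ A' o}) := by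
    ext o; by_cases h : p o <;> simp [h]
  rw [this]
  exact (hp.inter (hA j)).union (hp.compl.inter (hA' j))

/-- Serves both elimination and, with `c = 0`, the maximizers. -/
theorem measurableIndexSet_filter_forall {A : α → Finset ℕ} (hA : MeasurableIndexSet A)
    {f : α → ℕ → ℝ} (hf : ∀ j, Measurable fun o => f o j) (c : ℝ) :
    MeasurableIndexSet (fun o => (A o).filter (fun j => ∀ j' ∈ A o, f o j' - c ≤ f o j)) := by
  intro j
  have : {o | j ∈ (A o).filter (fun j => ∀ j' ∈ A o, f o j' - c ≤ f o j)} =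
      {o | j ∈ A o} ∩ ⋂ j', ({o | j' ∈ A o}ᶜ ∪ {o | f o j' - c ≤ f o j}) := by
    ext o
    simp only [Finset.mem_filter, Set.mem_ofPred_eq, Set.mem_inter_iff, Set.mem_iInter,
      Set.mem_union, Set.mem_compl_iff, imp_iff_not_or]
  rw [this]
  exact (hA j).inter (MeasurableSet.iInter fun j' =>
    (hA j').compl.union (measurableSet_le ((hf j').sub_const c) (hf j)))

theorem measurable_layerTraversal (B : ℝ) {width U : α → ℕ → ℕ → ℝ}
    (hw : ∀ s j, Measurable fun o => width o s j) (hU : ∀ s j, Measurable fun o => U o s j) :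
    ∀ (n s : ℕ) (A : α → Finset ℕ), MeasurableIndexSet A →
      Measurable (fun o => (layerTraversal B (width o) (U o) n s (A o)).1) ∧
      MeasurableIndexSet (fun o => (layerTraversal B (width o) (U o) n s (A o)).2) := by
  intro n
  induction n with
  | zero =>
    intro s A hA
    refine ⟨measurable_const, ?_⟩
    have := measurableIndexSet_filter_forall hA (hU s) 0
    simp only [sub_zero] at this
    exact this
  | succ n ih =>
    intro s A hA
    have hE : MeasurableIndexSet (fun o => underExplored B (width o) s (A o)) := by
      intro j
      have : {o | j ∈ underExplored B (width o) s (A o)} =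
          {o | j ∈ A o} ∩ {o | B / 2 ^ s < width o s j} := by
        ext o; simp [underExplored]
      rw [this]
      exact (hA j).inter (measurableSet_lt measurable_const (hw s j))
    obtain ⟨h1, h2⟩ := ih (s + 1) (fun o => eliminate B (U o) s (A o))
      (measurableIndexSet_filter_forall hA (hU s) _)
    simp only [layerTraversal, apply_ite]
    exact ⟨Measurable.ite hE.measurableSet_nonempty measurable_const h1,
      hE.ite h2 hE.measurableSet_nonempty⟩

end Traversal

section Episode

variable {X : Type*} [MeasurableSpace X] {B : ℝ} (R : SelectionRule X B) (oracle : Oracle X)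
  (δ : ℝ)

/-- The measurability conditions on the oracle, at level `δ`. -/
def MeasurableOracle (oracle : Oracle X) (δ : ℝ) : Prop :=
  (∀ n, 1 ≤ n → Measurable (fun q : (Fin n → X × ℝ) × X => oracle n δ q.1 q.2)) ∧
  ∀ n, 1 ≤ n → Measurable (fun D : Fin n → X × ℝ => supNorm (oracle n δ D))

/-- All components of a random decision are measurable. -/
def MeasurableDecision {α : Type*} [MeasurableSpace α] (d : α → Decision) : Prop :=
  Measurable (fun o => (d o).layer) ∧ Measurable (fun o => (d o).arm) ∧
    Measurable (fun o => (d o).price)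

variable {oracle δ}

theorem measurable_armPrice (h : MeasurableOracle oracle δ) (b : ℝ) (e t j : ℕ) :
    Measurable (fun o : ℕ → X × ℝ => armPrice oracle δ o b e t j) := by
  unfold armPrice estimator gridPoint
  split_ifs with he
  · exact measurable_const
  · have hn : 1 ≤ 2 ^ (e - 1) := Nat.one_le_two_pow
    have hD : Measurable (fun (o : ℕ → X × ℝ) (i : Fin (2 ^ (e - 1))) => o (2 ^ (e - 1) + i)) :=
      measurable_pi_lambda _ fun i => measurable_pi_apply _
    have h1 : Measurable (fun o : ℕ → X × ℝ =>
        supNorm (oracle (2 ^ (e - 1)) δ (fun i => o (2 ^ (e - 1) + i)))) :=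
      (h.2 _ hn).comp hD
    have h2 : Measurable (fun o : ℕ → X × ℝ =>
        oracle (2 ^ (e - 1)) δ (fun i => o (2 ^ (e - 1) + i)) (o t).1) :=
      (h.1 _ hn).comp (hD.prodMk (measurable_pi_apply t).fst)
    exact (h1.neg.add (measurable_const.mul
      ((measurable_const.add (measurable_const.mul h1)).div_const _))).add h2

theorem measurable_sale {α : Type*} [MeasurableSpace α] {v p : α → ℝ} (hv : Measurable v)
    (hp : Measurable p) : Measurable (fun o => sale (v o) (p o)) :=
  Measurable.ite (measurableSet_le hp hv) measurable_const measurable_const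

theorem measurableSet_layer_arm {t : ℕ}
    (h : MeasurableDecision (fun o : ℕ → X × ℝ => decision R oracle δ o t)) (s j : ℕ) :
    MeasurableSet {o : ℕ → X × ℝ | (decision R oracle δ o t).layer = s ∧
      (decision R oracle δ o t).arm = j} :=
  (h.1 (measurableSet_singleton s)).inter (h.2.1 (measurableSet_singleton j))

theorem measurable_sum_stopRounds {t : ℕ} (t₀ : ℕ)
    (h : ∀ τ < t, MeasurableDecision (fun o : ℕ → X × ℝ => decision R oracle δ o τ))
    {f : (ℕ → X × ℝ) → ℕ → ℝ} (hf : ∀ τ < t, Measurable fun o => f o τ) (s j : ℕ) :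
    Measurable (fun o => ∑ τ ∈ stopRounds R oracle δ o t₀ t s j, f o τ) := by
  simp only [stopRounds, Finset.sum_filter]
  refine Finset.measurable_sum _ fun τ hτ => ?_
  have hτ := (Finset.mem_Ico.1 hτ).2
  exact Measurable.ite (measurableSet_layer_arm R (h τ hτ) s j) (hf τ hτ) measurable_const

theorem measurable_card_stopRounds {t : ℕ} (t₀ : ℕ)
    (h : ∀ τ < t, MeasurableDecision (fun o : ℕ → X × ℝ => decision R oracle δ o τ)) (s j : ℕ) :
    Measurable (fun o => (stopRounds R oracle δ o t₀ t s j).card) := by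
  simp only [stopRounds, Finset.card_filter]
  refine Finset.measurable_sum _ fun τ hτ => ?_
  exact Measurable.ite (measurableSet_layer_arm R (h τ (Finset.mem_Ico.1 hτ).2) s j)
    measurable_const measurable_const

theorem measurable_decision (h : MeasurableOracle oracle δ) (t : ℕ) :
    MeasurableDecision (fun o : ℕ → X × ℝ => decision R oracle δ o t) := by
  induction t using Nat.strong_induction_on with
  | _ t ih =>
    have hpast : Measurable (fun o : ℕ → X × ℝ => ((fun i : Fin t => o i), (o t).1)) :=
      (measurable_pi_lambda _ fun i => measurable_pi_apply _).prodMk (measurable_pi_apply t).fst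
    have hfb := (R.measurable_fallback t).comp hpast
    rcases eq_or_ne t 0 with rfl | ht
    · simp only [decision_zero]
      exact ⟨measurable_const, measurable_const, hfb⟩
    obtain ⟨e, h1, h2⟩ := exists_episode ht
    have hP := measurable_armPrice h B e t
    have hcard := measurable_card_stopRounds R (2 ^ e) ih
    have hrad : ∀ s j, Measurable (fun o => armRadius R oracle δ o e t s j) := fun s j =>
      (Measurable.of_discrete (f := radius δ (numLayers (2 ^ e)) (numGrid (2 ^ e)) (2 ^ e))).comp
        (hcard s j)
    have hmean : ∀ s j, Measurable (fun o => armMean R oracle δ o e t s j) := fun s j =>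
      (measurable_sum_stopRounds R (2 ^ e) ih (fun τ hτ =>
        measurable_sale (measurable_pi_apply τ).snd (ih τ hτ).2.2) s j).div
        ((Measurable.of_discrete (f := fun n : ℕ => (n : ℝ))).comp (hcard s j))
    have hcand : MeasurableIndexSet (fun o => candidates oracle δ o B e t) := by
      intro j
      simp only [candidates, Finset.mem_filter]
      by_cases hj : j ∈ Finset.Icc 1 (numGrid (2 ^ e))
      · simp only [hj, true_and]
        exact (measurableSet_lt measurable_const (hP j)).inter
          (measurableSet_lt (hP j) measurable_const)
      · simp [hj]
    obtain ⟨htr1, htr2⟩ := measurable_layerTraversal B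
      (width := fun o s j => armPrice oracle δ o B e t j * armRadius R oracle δ o e t s j)
      (U := fun o s j => armPrice oracle δ o B e t j *
        (armMean R oracle δ o e t s j + armRadius R oracle δ o e t s j))
      (fun s j => (hP j).mul (hrad s j)) (fun s j => (hP j).mul ((hmean s j).add (hrad s j)))
      (numLayers (2 ^ e) - 1) 1 _ hcand
    have harm : Measurable (fun o => chosenArm R oracle δ o e t) := by
      refine measurable_to_countable' fun k => ?_
      -- `pick` is measurable only for a fixed candidate set, but there are countably many such
      -- sets.
      have : (fun o => chosenArm R oracle δ o e t) ⁻¹' {k} = ⋃ A : Finset ℕ,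
          {o | (traversal R oracle δ o e t).2 = A} ∩
            {o : ℕ → X × ℝ | R.pick t (fun i : Fin t => o i) (o t).1 A = k} := by
        ext o; simp [chosenArm]
      rw [this]
      exact MeasurableSet.iUnion fun A => (htr2.measurableSet_eq A).inter
        (((R.measurable_pick t A).comp hpast) (measurableSet_singleton k))
    have hprice : Measurable
        (fun o => armPrice oracle δ o B e t (chosenArm R oracle δ o e t)) :=
      measurable_apply_index (f := fun j o => armPrice oracle δ o B e t j) hP harm
    simp only [decision_eq R oracle δ _ h1 h2]
    refine ⟨?_, ?_, ?_⟩
    · simp only [apply_ite]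
      exact Measurable.ite hcand.measurableSet_nonempty htr1 measurable_const
    · simp only [apply_ite]
      exact Measurable.ite hcand.measurableSet_nonempty harm measurable_const
    · simp only [apply_ite]
      exact Measurable.ite hcand.measurableSet_nonempty hprice hfb

/-- Non-anticipation: the decision ignores the current valuation, so it is fixed before the current
noise is drawn. -/
theorem decision_congr (oracle : Oracle X) (δ : ℝ) {o o' : ℕ → X × ℝ} {t : ℕ}
    (h : ∀ i < t, o i = o' i) (hx : (o t).1 = (o' t).1) :
    decision R oracle δ o t = decision R oracle δ o' t := by
  induction t using Nat.strong_induction_on with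
  | _ t ih =>
    have hpast : (fun i : Fin t => o i) = fun i : Fin t => o' i := by
      funext i; exact h i i.isLt
    have hdec : (fun τ : Fin t => decision R oracle δ o τ) =
        fun τ : Fin t => decision R oracle δ o' τ := by
      funext τ
      exact ih τ τ.isLt (fun i hi => h i (hi.trans τ.isLt)) (by rw [h τ τ.isLt])
    rw [decision, decision]
    split_ifs with ht
    · rw [hpast, hx]
    · have hest : estimator oracle δ o (Nat.log 2 t) = estimator oracle δ o' (Nat.log 2 t) := by
        unfold estimator
        split_ifs with he
        · rfl
        · congr 1
          funext i
          refine h _ (lt_of_lt_of_le ?_ (Nat.pow_log_le_self 2 ht))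
          have hi := i.isLt
          have hpow : 2 ^ Nat.log 2 t = 2 ^ (Nat.log 2 t - 1) * 2 := by
            rw [← pow_succ, Nat.sub_add_cancel (Nat.one_le_iff_ne_zero.2 he)]
          omega
      rw [hpast, hx, hdec, hest]

end Episode

open MeasureTheory ProbabilityTheory

/-! ### Sale outcomes as Bernoulli variables -/

section Sale

variable {ν : Measure ℝ} [IsProbabilityMeasure ν] {L : ℝ}

/-- A sale occurs already at equality `v = p`, so the strict half-line is needed. A Lipschitz
distribution function has no atoms. -/
theorem measure_Iio_eq_cdf (hFL : ∀ u w, |cdf ν u - cdf ν w| ≤ L * |u - w|) (u : ℝ) :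
    ν.real (Set.Iio u) = cdf ν u := by
  have hcont : Continuous (cdf ν) := by
    have : LipschitzWith (Real.toNNReal L) (cdf ν) := by
      refine LipschitzWith.of_dist_le_mul fun a b => ?_
      rw [Real.dist_eq, Real.dist_eq]
      exact (hFL a b).trans (mul_le_mul_of_nonneg_right (Real.le_coe_toNNReal L) (abs_nonneg _))
    exact this.continuous
  have hatom : ν {u} = 0 := by
    rw [← measure_cdf ν, StieltjesFunction.measure_singleton,
      (hcont.continuousAt (x := u)).continuousWithinAt.leftLim_eq, sub_self, ENNReal.ofReal_zero]
  rw [cdf_eq_real, measureReal_def, measureReal_def, ← Set.Iio_union_right]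
  rw [measure_union (by simp) (measurableSet_singleton u), hatom, add_zero]

theorem integral_sale (hFL : ∀ u w, |cdf ν u - cdf ν w| ≤ L * |u - w|) (q p : ℝ) :
    ∫ e, sale (q + e) p ∂ν = 1 - cdf ν (p - q) := by
  have h1 : (fun e => sale (q + e) p) = (Set.Iio (p - q))ᶜ.indicator (1 : ℝ → ℝ) := by
    funext e
    simp only [sale, Set.indicator, Set.mem_compl_iff, Set.mem_Iio, not_lt, sub_le_iff_le_add',
      Pi.one_apply]
  rw [h1, integral_indicator_one measurableSet_Iio.compl,
    probReal_compl_eq_one_sub measurableSet_Iio, measure_Iio_eq_cdf hFL]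

/-- Hoeffding's lemma on `[0, 1]`: the variance proxy is `1/4`, hence the compensator `l ^ 2 / 8`.
-/
theorem lintegral_exp_sale_le (hFL : ∀ u w, |cdf ν u - cdf ν w| ≤ L * |u - w|) (q p l : ℝ) :
    ∫⁻ e, ENNReal.ofReal
      (Real.exp (l * (sale (q + e) p - (1 - cdf ν (p - q))) - l ^ 2 / 8)) ∂ν ≤ 1 := by
  have hm : Measurable (fun e => sale (q + e) p) :=
    measurable_sale (measurable_const.add measurable_id) measurable_const
  have hsub := hasSubgaussianMGF_of_mem_Icc (μ := ν) hm.aemeasurable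
    (Filter.Eventually.of_forall fun e => sale_mem (q + e) p)
  rw [integral_sale hFL] at hsub
  have hmgf := hsub.mgf_le l
  have hint := hsub.integrable_exp_mul l
  have heq : ∀ e, Real.exp (l * (sale (q + e) p - (1 - cdf ν (p - q))) - l ^ 2 / 8) =
      Real.exp (l * (sale (q + e) p - (1 - cdf ν (p - q)))) * Real.exp (-(l ^ 2 / 8)) := by
    intro e; rw [← Real.exp_add, sub_eq_add_neg]
  rw [← ofReal_integral_eq_lintegral_ofReal]
  · refine ENNReal.ofReal_le_one.2 ?_
    simp only [heq]
    rw [integral_mul_const]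
    unfold mgf at hmgf
    refine (mul_le_mul_of_nonneg_right hmgf (Real.exp_pos _).le).trans ?_
    rw [← Real.exp_add, Real.exp_le_one_iff]
    have : (((‖(1 : ℝ) - 0‖₊ / 2) ^ 2 : NNReal) : ℝ) = 1 / 4 := by
      push_cast; norm_num
    rw [this]
    linarith
  · simp only [heq]; exact hint.mul_const _
  · exact Filter.Eventually.of_forall fun e => (Real.exp_pos _).le

end Sale

/-! ### Independence of the noise from the past -/

section Extend

variable {X : Type*}

/-- The sequence with the given past, context and valuation, and constant afterwards. -/
def extendPast {t : ℕ} (h : Fin t → X × ℝ) (z : X) (v : ℝ) (i : ℕ) : X × ℝ :=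
  if hi : i < t then h ⟨i, hi⟩ else (z, v)

theorem extendPast_of_lt {t i : ℕ} (hi : i < t) (h : Fin t → X × ℝ) (z : X) (v v' : ℝ) :
    extendPast h z v i = extendPast h z v' i := by
  simp [extendPast, hi]

theorem extendPast_self {t : ℕ} (h : Fin t → X × ℝ) (z : X) (v : ℝ) :
    extendPast h z v t = (z, v) := by
  simp [extendPast]

end Extend

section Past

variable {X Ω : Type*} [MeasurableSpace X] [MeasurableSpace Ω] {μ : Measure Ω}
  [IsProbabilityMeasure μ] {PX : Measure X} {ν : Measure ℝ} {x : ℕ → Ω → X} {ε : ℕ → Ω → ℝ} {vstar : X → ℝ}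

/-- The sequence of pairs of contexts and valuations. -/
def observations (x : ℕ → Ω → X) (ε : ℕ → Ω → ℝ) (vstar : X → ℝ) (ω : Ω) (t : ℕ) : X × ℝ :=
  (x t ω, vstar (x t ω) + ε t ω)

theorem measurable_observations (hx : ∀ t, Measurable (x t)) (hε : ∀ t, Measurable (ε t))
    (hv : Measurable vstar) : Measurable (observations x ε vstar) :=
  measurable_pi_lambda _ fun t => (hx t).prodMk ((hv.comp (hx t)).add (hε t))

/-- Independence across rounds splits off the past; independence within the round separates context
from noise. -/
theorem map_past_context_noise (hx : ∀ t, Measurable (x t)) (hε : ∀ t, Measurable (ε t))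
    (hxlaw : ∀ t, μ.map (x t) = PX) (hεlaw : ∀ t, μ.map (ε t) = ν)
    (hindep : iIndepFun (fun t ω => (x t ω, ε t ω)) μ)
    (hxε : ∀ t, IndepFun (x t) (ε t) μ) (hv : Measurable vstar) (t : ℕ) :
    μ.map (fun ω => ((fun i : Fin t => observations x ε vstar ω i), (x t ω, ε t ω))) =
      (μ.map (fun ω => fun i : Fin t => observations x ε vstar ω i)).prod (PX.prod ν) := by
  have h1 := hindep.indepFun_finset (Finset.range t) {t} (by simp)
    (fun i => (hx i).prodMk (hε i))
  have h2 := h1.comp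
    (φ := fun g (i : Fin t) => ((g ⟨i, Finset.mem_range.2 i.isLt⟩).1,
      vstar (g ⟨i, Finset.mem_range.2 i.isLt⟩).1 + (g ⟨i, Finset.mem_range.2 i.isLt⟩).2))
    (ψ := fun g => g ⟨t, Finset.mem_singleton_self t⟩)
    (measurable_pi_lambda _ fun i => by fun_prop)
    (measurable_pi_apply (X := fun _ : ({t} : Finset ℕ) => X × ℝ) ⟨t, Finset.mem_singleton_self t⟩)
  have h3 := (indepFun_iff_map_prod_eq_prod_map_map
    (measurable_pi_lambda _ fun i => by fun_prop).aemeasurable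
    (by fun_prop)).1 h2
  have h4 := (indepFun_iff_map_prod_eq_prod_map_map (hx t).aemeasurable (hε t).aemeasurable).1
    (hxε t)
  rw [hxlaw, hεlaw] at h4
  rw [← h4]
  exact h3

variable [IsProbabilityMeasure PX] [IsProbabilityMeasure ν]

/-- A factor whose conditional expectation given the past and the context is at most `1` can be
dropped. -/
theorem lintegral_mul_le_of_past (hx : ∀ t, Measurable (x t)) (hε : ∀ t, Measurable (ε t))
    (hxlaw : ∀ t, μ.map (x t) = PX) (hεlaw : ∀ t, μ.map (ε t) = ν)
    (hindep : iIndepFun (fun t ω => (x t ω, ε t ω)) μ)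
    (hxε : ∀ t, IndepFun (x t) (ε t) μ) (hv : Measurable vstar) (t : ℕ)
    {W Z : (ℕ → X × ℝ) → ENNReal} (hW : Measurable W) (hZ : Measurable Z)
    (hWdep : ∀ o o', (∀ i < t, o i = o' i) → W o = W o')
    (hZdep : ∀ o o', (∀ i ≤ t, o i = o' i) → Z o = Z o')
    (hZle : ∀ (h : Fin t → X × ℝ) z, ∫⁻ e, Z (extendPast h z (vstar z + e)) ∂ν ≤ 1) :
    ∫⁻ ω, W (observations x ε vstar ω) * Z (observations x ε vstar ω) ∂μ ≤
      ∫⁻ ω, W (observations x ε vstar ω) ∂μ := by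
  -- Fubini on the product law replaces conditional expectations. `W` and `Z` only see indices up to
  -- `t`, so the sequence may be continued arbitrarily.
  let ext : (Fin t → X × ℝ) × (X × ℝ) → ℕ → X × ℝ :=
    fun q => extendPast q.1 q.2.1 (vstar q.2.1 + q.2.2)
  have hext : Measurable ext := by
    refine measurable_pi_lambda _ fun i => ?_
    by_cases hi : i < t
    · simp only [ext, extendPast, hi, dif_pos]; fun_prop
    · simp only [ext, extendPast, hi, dif_neg, not_false_eq_true]; fun_prop
  let past : Ω → (Fin t → X × ℝ) × (X × ℝ) :=
    fun ω => ((fun i : Fin t => observations x ε vstar ω i), (x t ω, ε t ω))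
  have hobs := measurable_observations hx hε hv
  have hpast : Measurable past :=
    (measurable_pi_lambda _ fun i => (measurable_pi_apply _).comp hobs).prodMk
      ((hx t).prodMk (hε t))
  have hagree : ∀ ω, ∀ i ≤ t, observations x ε vstar ω i = ext (past ω) i := by
    intro ω i hi
    rcases hi.eq_or_lt with rfl | hlt
    · simp only [ext, extendPast_self]; rfl
    · simp [ext, extendPast, hlt, past]
  have hWeq : ∀ ω, W (observations x ε vstar ω) = W (ext (past ω)) := fun ω =>
    hWdep _ _ fun i hi => hagree ω i hi.le
  have hZeq : ∀ ω, Z (observations x ε vstar ω) = Z (ext (past ω)) := fun ω =>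
    hZdep _ _ fun i hi => hagree ω i hi
  have hlaw := map_past_context_noise hx hε hxlaw hεlaw hindep hxε hv t
  simp only [hWeq, hZeq]
  have hWe : Measurable (fun q => W (ext q)) := hW.comp hext
  have hZe : Measurable (fun q => Z (ext q)) := hZ.comp hext
  have hWZ : Measurable (fun q => W (ext q) * Z (ext q)) := hWe.mul hZe
  rw [← lintegral_map (f := fun q => W (ext q) * Z (ext q)) hWZ hpast,
    ← lintegral_map (f := fun q => W (ext q)) hWe hpast]
  simp only [past]
  rw [hlaw]
  have hP : IsProbabilityMeasure (μ.map (fun ω => fun i : Fin t => observations x ε vstar ω i)) :=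
    Measure.isProbabilityMeasure_map
      (measurable_pi_lambda _ fun i => (measurable_pi_apply _).comp hobs).aemeasurable
  rw [lintegral_prod _ hWZ.aemeasurable, lintegral_prod _ hWe.aemeasurable]
  refine lintegral_mono fun h => ?_
  rw [lintegral_prod (fun y => W (ext (h, y)) * Z (ext (h, y)))
      (hWZ.comp measurable_prodMk_left).aemeasurable,
    lintegral_prod (fun y => W (ext (h, y))) (hWe.comp measurable_prodMk_left).aemeasurable]
  refine lintegral_mono fun z => ?_
  have hconst : ∀ e, W (ext (h, z, e)) = W (ext (h, z, 0)) := fun e =>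
    hWdep _ _ fun i hi => extendPast_of_lt hi _ _ _ _
  simp only [hconst]
  have hZz : Measurable (fun e => Z (ext (h, z, e))) :=
    hZe.comp (measurable_prodMk_left.comp measurable_prodMk_left)
  rw [lintegral_const_mul _ hZz,
    lintegral_const, measure_univ]
  exact mul_le_mul_right (hZle h z) _

end Past

/-! ### Concentration of the sale outcomes -/

section Concentration

variable {X : Type*} [MeasurableSpace X] {B : ℝ} (R : SelectionRule X B) (oracle : Oracle X)
  (δ : ℝ) (F : ℝ → ℝ) (vstar : X → ℝ)

/-- The exponent of the exponential supermartingale of a layer and an index. -/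
noncomputable def expDeviation (l : ℝ) (e t s j : ℕ) (o : ℕ → X × ℝ) : ℝ :=
  ∑ τ ∈ stopRounds R oracle δ o (2 ^ e) t s j,
    (l * (sale (o τ).2 (decision R oracle δ o τ).price - demand R oracle δ o F vstar τ) -
      l ^ 2 / 8)

/-- The increment at index `t` of the exponent of the exponential supermartingale. -/
noncomputable def expIncrement (l : ℝ) (t s j : ℕ) (o : ℕ → X × ℝ) : ℝ :=
  if (decision R oracle δ o t).layer = s ∧ (decision R oracle δ o t).arm = j then
    l * (sale (o t).2 (decision R oracle δ o t).price - demand R oracle δ o F vstar t) - l ^ 2 / 8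
  else 0

theorem expDeviation_eq (l : ℝ) (e t s j : ℕ) (o : ℕ → X × ℝ) :
    expDeviation R oracle δ F vstar l e t s j o =
      l * deviation R oracle δ o F vstar e t s j -
        l ^ 2 / 8 * (stopRounds R oracle δ o (2 ^ e) t s j).card := by
  rw [expDeviation, deviation, Finset.sum_sub_distrib, Finset.mul_sum, Finset.sum_const,
    nsmul_eq_mul, mul_comm (l ^ 2 / 8)]

theorem expDeviation_eq_sum (l : ℝ) (e t s j : ℕ) (o : ℕ → X × ℝ) :
    expDeviation R oracle δ F vstar l e t s j o =
      ∑ τ ∈ Finset.Ico (2 ^ e) t, expIncrement R oracle δ F vstar l τ s j o := by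
  rw [expDeviation, stopRounds, Finset.sum_filter]; rfl

theorem expDeviation_succ (l : ℝ) {e t : ℕ} (ht : 2 ^ e ≤ t) (s j : ℕ) (o : ℕ → X × ℝ) :
    expDeviation R oracle δ F vstar l e (t + 1) s j o =
      expDeviation R oracle δ F vstar l e t s j o + expIncrement R oracle δ F vstar l t s j o := by
  rw [expDeviation_eq_sum, expDeviation_eq_sum, Finset.sum_Ico_succ_top ht]

theorem expIncrement_congr (l : ℝ) (t s j : ℕ) {o o' : ℕ → X × ℝ} (h : ∀ i ≤ t, o i = o' i) :
    expIncrement R oracle δ F vstar l t s j o = expIncrement R oracle δ F vstar l t s j o' := by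
  have hd := decision_congr R oracle δ (fun i hi => h i (le_of_lt hi)) (by rw [h t le_rfl])
  simp only [expIncrement, demand, hd, h t le_rfl]

variable {oracle δ F vstar}

theorem measurable_expIncrement (h : MeasurableOracle oracle δ) (hF : Measurable F)
    (hv : Measurable vstar) (l : ℝ) (t s j : ℕ) :
    Measurable (expIncrement R oracle δ F vstar l t s j) := by
  have hd := measurable_decision R h t
  have hs : Measurable (fun o : ℕ → X × ℝ => sale (o t).2 (decision R oracle δ o t).price) :=
    measurable_sale (measurable_pi_apply t).snd hd.2.2
  have hdem : Measurable (fun o : ℕ → X × ℝ => demand R oracle δ o F vstar t) :=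
    measurable_const.sub (hF.comp (hd.2.2.sub (hv.comp (measurable_pi_apply t).fst)))
  exact Measurable.ite (measurableSet_layer_arm R hd s j)
    (((hs.sub hdem).const_mul l).sub_const _) measurable_const

theorem measurable_expDeviation (h : MeasurableOracle oracle δ) (hF : Measurable F)
    (hv : Measurable vstar) (l : ℝ) (e t s j : ℕ) :
    Measurable (expDeviation R oracle δ F vstar l e t s j) := by
  have : expDeviation R oracle δ F vstar l e t s j = fun o =>
      ∑ τ ∈ Finset.Ico (2 ^ e) t, expIncrement R oracle δ F vstar l τ s j o := by
    funext o; exact expDeviation_eq_sum R oracle δ F vstar l e t s j o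
  rw [this]
  exact Finset.measurable_sum _ fun τ _ => measurable_expIncrement R h hF hv l τ s j

variable {Ω : Type*} [MeasurableSpace Ω] {μ : Measure Ω}
  [IsProbabilityMeasure μ] {PX : Measure X} [IsProbabilityMeasure PX] {ν : Measure ℝ}
  [IsProbabilityMeasure ν] {x : ℕ → Ω → X} {ε : ℕ → Ω → ℝ} {L : ℝ}

theorem lintegral_exp_increment_le (hFL : ∀ u w, |cdf ν u - cdf ν w| ≤ L * |u - w|)
    (l : ℝ) {t : ℕ} (s j : ℕ) (h : Fin t → X × ℝ) (z : X) :
    ∫⁻ e, ENNReal.ofReal (Real.exp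
      (expIncrement R oracle δ (cdf ν) vstar l t s j (extendPast h z (vstar z + e)))) ∂ν ≤ 1 := by
  have hd : ∀ e, decision R oracle δ (extendPast h z (vstar z + e)) t =
      decision R oracle δ (extendPast h z 0) t := fun e =>
    decision_congr R oracle δ (fun i hi => extendPast_of_lt hi _ _ _ _)
      (by rw [extendPast_self, extendPast_self])
  simp only [expIncrement, demand, hd, extendPast_self]
  split_ifs with hc
  · exact lintegral_exp_sale_le hFL _ _ l
  · simp

/-- The supermartingale property. Whether a round is recorded in the layer and index is settled
before its noise, so each increment has conditional exponential mean at most `1`, recorded or not.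
-/
theorem lintegral_exp_expDeviation_le (ho : MeasurableOracle oracle δ)
    (hx : ∀ t, Measurable (x t)) (hε : ∀ t, Measurable (ε t))
    (hxlaw : ∀ t, μ.map (x t) = PX) (hεlaw : ∀ t, μ.map (ε t) = ν)
    (hindep : iIndepFun (fun t ω => (x t ω, ε t ω)) μ)
    (hxε : ∀ t, IndepFun (x t) (ε t) μ) (hv : Measurable vstar)
    (hFL : ∀ u w, |cdf ν u - cdf ν w| ≤ L * |u - w|) (l : ℝ) {e t : ℕ} (ht : 2 ^ e ≤ t)
    (s j : ℕ) :
    ∫⁻ ω, ENNReal.ofReal (Real.exp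
      (expDeviation R oracle δ (cdf ν) vstar l e t s j (observations x ε vstar ω))) ∂μ ≤ 1 := by
  have hF : Measurable (cdf ν) := (monotone_cdf ν).measurable
  induction t, ht using Nat.le_induction with
  | base => simp [expDeviation_eq_sum]
  | succ t ht ih =>
    refine le_trans ?_ ih
    simp only [expDeviation_succ R oracle δ (cdf ν) vstar l ht, Real.exp_add,
      ENNReal.ofReal_mul (Real.exp_pos _).le]
    refine lintegral_mul_le_of_past hx hε hxlaw hεlaw hindep hxε hv t
      (W := fun o => ENNReal.ofReal (Real.exp (expDeviation R oracle δ (cdf ν) vstar l e t s j o)))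
      (Z := fun o => ENNReal.ofReal (Real.exp (expIncrement R oracle δ (cdf ν) vstar l t s j o)))
      (measurable_expDeviation R ho hF hv l e t s j).exp.ennreal_ofReal
      (measurable_expIncrement R ho hF hv l t s j).exp.ennreal_ofReal ?_ ?_
      (lintegral_exp_increment_le R hFL l s j)
    · intro o o' h
      simp only [expDeviation_eq_sum]
      rw [Finset.sum_congr rfl fun τ hτ => expIncrement_congr R oracle δ (cdf ν) vstar l τ s j
        fun i hi => h i (lt_of_le_of_lt hi (Finset.mem_Ico.1 hτ).2)]
    · intro o o' h
      simp only [expIncrement_congr R oracle δ (cdf ν) vstar l t s j h]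

/-- Large deviations of the sale outcomes of one layer and one index, for a given number of
samples, in the direction `σ ∈ {1, -1}`. -/
theorem measure_deviation_gt_le (ho : MeasurableOracle oracle δ)
    (hx : ∀ t, Measurable (x t)) (hε : ∀ t, Measurable (ε t))
    (hxlaw : ∀ t, μ.map (x t) = PX) (hεlaw : ∀ t, μ.map (ε t) = ν)
    (hindep : iIndepFun (fun t ω => (x t ω, ε t ω)) μ)
    (hxε : ∀ t, IndepFun (x t) (ε t) μ) (hv : Measurable vstar)
    (hFL : ∀ u w, |cdf ν u - cdf ν w| ≤ L * |u - w|) {e t : ℕ} (ht : 2 ^ e ≤ t)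
    (s j : ℕ) {n : ℕ} (hn : 0 < n) {σ Λ : ℝ} (hσ : σ ^ 2 = 1) (hΛ : 0 ≤ Λ) :
    μ {ω | (stopRounds R oracle δ (observations x ε vstar ω) (2 ^ e) t s j).card = n ∧
      n * √(2 * Λ / n) ≤
        σ * deviation R oracle δ (observations x ε vstar ω) (cdf ν) vstar e t s j} ≤
      ENNReal.ofReal (Real.exp (-(4 * Λ))) := by
  have hn' : (0 : ℝ) < n := by exact_mod_cast hn
  set r := √(2 * Λ / n) with hr
  have hr2 : r ^ 2 = 2 * Λ / n := Real.sq_sqrt (by positivity)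
  have hnr : n * r ^ 2 = 2 * Λ := by rw [hr2]; field_simp
  have hr0 : 0 ≤ r := Real.sqrt_nonneg _
  -- `l = 4r` maximizes `l n r - l² n / 8`; the value `2 n r²` is `4Λ`.
  have hint := lintegral_exp_expDeviation_le R ho hx hε hxlaw hεlaw hindep hxε hv hFL
    (4 * r * σ) ht s j
  have hmeas : Measurable (fun ω => ENNReal.ofReal (Real.exp (expDeviation R oracle δ (cdf ν) vstar
      (4 * r * σ) e t s j (observations x ε vstar ω)))) :=
    ((measurable_expDeviation R ho (monotone_cdf ν).measurable hv _ e t s j).comp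
      (measurable_observations hx hε hv)).exp.ennreal_ofReal
  have hpos : 0 < Real.exp (4 * Λ) := Real.exp_pos _
  have hmarkov := meas_ge_le_lintegral_div (μ := μ) hmeas.aemeasurable
    (ε := ENNReal.ofReal (Real.exp (4 * Λ))) (by simpa using hpos) ENNReal.ofReal_ne_top
  refine (measure_mono ?_).trans (hmarkov.trans ((ENNReal.div_le_div_right hint _).trans ?_))
  · rintro ω ⟨hcard, hdev⟩
    refine ENNReal.ofReal_le_ofReal (Real.exp_le_exp.2 ?_)
    rw [expDeviation_eq, hcard]
    have h1 := mul_le_mul_of_nonneg_left hdev (by positivity : 0 ≤ 4 * r)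
    have h2 : (4 * r * σ) ^ 2 / 8 * n = 2 * (n * r ^ 2) * σ ^ 2 := by ring
    rw [h2, hσ, hnr]
    have h3 : 4 * r * (n * r) = 4 * (n * r ^ 2) := by ring
    rw [h3, hnr] at h1
    linarith
  · rw [Real.exp_neg, ENNReal.ofReal_inv_of_pos hpos, one_div]

/-- With `q = 2SNT/δ`, each event has probability at most `q⁻⁴`, and there are `qδT ≤ q²δ` of them.
-/
theorem union_count_le {δ : ℝ} {T : ℕ} (hT : 0 < T) (hδ : 0 < δ) (hδ1 : δ ≤ 1) :
    (T * (numLayers T) * (numGrid T) * T * 2 : ℝ) * Real.exp (-(4 * logFactor δ T)) ≤ δ := by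
  have h1 : (1 : ℝ) ≤ numLayers T := by exact_mod_cast one_le_numLayers T
  have h2 : (1 : ℝ) ≤ numGrid T := by exact_mod_cast numGrid_pos hT
  have h3 : (1 : ℝ) ≤ T := by exact_mod_cast hT
  have h12 : (1 : ℝ) ≤ numLayers T * numGrid T := one_le_mul_of_one_le_of_one_le h1 h2
  have hTle : (T : ℝ) ≤ numLayers T * numGrid T * T := le_mul_of_one_le_left (by positivity) h12
  set q := 2 * (numLayers T : ℝ) * (numGrid T) * T / δ with hq
  have hqδ : q * δ = 2 * (numLayers T : ℝ) * (numGrid T) * T := by rw [hq]; field_simp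
  have hq0 : 0 < q := by rw [hq]; positivity
  have hqT : (T : ℝ) ≤ q := by
    rw [hq, le_div_iff₀ hδ]; nlinarith
  have hq1 : 1 ≤ q := h3.trans hqT
  have hexp : Real.exp (-(4 * logFactor δ T)) = (q ^ 4)⁻¹ := by
    rw [Real.exp_neg, logFactor, ← hq, show (4 : ℝ) * Real.log q = ((4 : ℕ) : ℝ) * Real.log q by
      norm_num, Real.exp_nat_mul, Real.exp_log hq0]
  rw [hexp, mul_inv_le_iff₀ (by positivity)]
  calc (T * (numLayers T) * (numGrid T) * T * 2 : ℝ) = q * δ * T := by rw [hqδ]; ring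
    _ ≤ q * δ * q := by gcongr
    _ = δ * q ^ 2 := by ring
    _ ≤ δ * q ^ 4 := by gcongr; norm_num

theorem measure_not_concentrates_le (ho : MeasurableOracle oracle δ)
    (hx : ∀ t, Measurable (x t)) (hε : ∀ t, Measurable (ε t))
    (hxlaw : ∀ t, μ.map (x t) = PX) (hεlaw : ∀ t, μ.map (ε t) = ν)
    (hindep : iIndepFun (fun t ω => (x t ω, ε t ω)) μ)
    (hxε : ∀ t, IndepFun (x t) (ε t) μ) (hv : Measurable vstar)
    (hFL : ∀ u w, |cdf ν u - cdf ν w| ≤ L * |u - w|) (hδ : 0 < δ) (hδ2 : δ ≤ 1 / 2) (e : ℕ) :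
    μ {ω | ¬ Concentrates R oracle δ (observations x ε vstar ω) (cdf ν) vstar e} ≤
      ENNReal.ofReal δ := by
  have hT : 0 < 2 ^ e := by positivity
  have hΛ : 0 ≤ logFactor δ (2 ^ e) := zero_le_one.trans (logFactor_ge_one hT hδ hδ2)
  -- Time, layer, index, number of samples, sign. The number of samples is random and must be fixed
  -- before the exponential parameter can be chosen.
  let K : Finset (ℕ × ℕ × ℕ × ℕ × ℝ) := Finset.Ico (2 ^ e) (2 ^ (e + 1)) ×ˢ
    Finset.Icc 1 (numLayers (2 ^ e)) ×ˢ Finset.Icc 1 (numGrid (2 ^ e)) ×ˢ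
    Finset.Icc 1 (2 ^ e) ×ˢ {1, -1}
  let E : ℕ × ℕ × ℕ × ℕ × ℝ → Set Ω := fun k =>
    {ω | (stopRounds R oracle δ (observations x ε vstar ω) (2 ^ e) k.1 k.2.1 k.2.2.1).card =
        k.2.2.2.1 ∧
      k.2.2.2.1 * √(2 * logFactor δ (2 ^ e) / k.2.2.2.1) ≤ k.2.2.2.2 *
        deviation R oracle δ (observations x ε vstar ω) (cdf ν) vstar e k.1 k.2.1 k.2.2.1}
  have hsub : {ω | ¬ Concentrates R oracle δ (observations x ε vstar ω) (cdf ν) vstar e} ⊆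
      ⋃ k ∈ K, E k := by
    intro ω hω
    simp only [Set.mem_ofPred_eq, Concentrates, not_forall, not_le] at hω
    obtain ⟨t, ht, s, hs, j, hj, hpos, hlt⟩ := hω
    have hcard : (stopRounds R oracle δ (observations x ε vstar ω) (2 ^ e) t s j).card ≤
        2 ^ e := by
      refine (Finset.card_filter_le _ _).trans ?_
      rw [Nat.card_Ico]
      have := (Finset.mem_Ico.1 ht).2
      rw [pow_succ] at this
      omega
    simp only [Set.mem_iUnion]
    obtain ⟨σ, hσ, hσdev⟩ : ∃ σ ∈ ({1, -1} : Finset ℝ),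
        |deviation R oracle δ (observations x ε vstar ω) (cdf ν) vstar e t s j| =
          σ * deviation R oracle δ (observations x ε vstar ω) (cdf ν) vstar e t s j := by
      rcases abs_choice (deviation R oracle δ (observations x ε vstar ω) (cdf ν) vstar e t s j)
        with h | h
      · exact ⟨1, by simp, by rw [h, one_mul]⟩
      · exact ⟨-1, by simp, by rw [h, neg_one_mul]⟩
    refine ⟨(t, s, j, (stopRounds R oracle δ (observations x ε vstar ω) (2 ^ e) t s j).card, σ),
      ?_, rfl, ?_⟩
    · simp only [K, Finset.mem_product]
      exact ⟨ht, hs, hj, Finset.mem_Icc.2 ⟨hpos, hcard⟩, hσ⟩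
    · exact (hσdev ▸ hlt).le
  have hE : ∀ k ∈ K, μ (E k) ≤ ENNReal.ofReal (Real.exp (-(4 * logFactor δ (2 ^ e)))) := by
    rintro ⟨t, s, j, n, σ⟩ hk
    simp only [K, Finset.mem_product] at hk
    obtain ⟨ht, -, -, hn, hσ⟩ := hk
    refine measure_deviation_gt_le R ho hx hε hxlaw hεlaw hindep hxε hv hFL
      (Finset.mem_Ico.1 ht).1 s j (Finset.mem_Icc.1 hn).1 ?_ hΛ
    rcases Finset.mem_insert.1 hσ with h | h
    · rw [h]; norm_num
    · rw [Finset.mem_singleton.1 h]; norm_num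
  have hKcard : K.card = 2 ^ e * numLayers (2 ^ e) * numGrid (2 ^ e) * 2 ^ e * 2 := by
    have h2 : ({1, -1} : Finset ℝ).card = 2 := Finset.card_pair (by norm_num)
    simp only [K, Finset.card_product, Nat.card_Ico, Nat.card_Icc, h2, Nat.add_sub_cancel]
    rw [pow_succ, mul_two, Nat.add_sub_cancel]
    ring
  calc μ {ω | ¬ Concentrates R oracle δ (observations x ε vstar ω) (cdf ν) vstar e}
      ≤ μ (⋃ k ∈ K, E k) := measure_mono hsub
    _ ≤ ∑ k ∈ K, μ (E k) := measure_biUnion_finset_le _ _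
    _ ≤ K.card • ENNReal.ofReal (Real.exp (-(4 * logFactor δ (2 ^ e)))) :=
      Finset.sum_le_card_nsmul _ _ _ hE
    _ = ENNReal.ofReal (K.card * Real.exp (-(4 * logFactor δ (2 ^ e)))) := by
      rw [nsmul_eq_mul, ENNReal.ofReal_mul (by positivity), ENNReal.ofReal_natCast]
    _ ≤ ENNReal.ofReal δ := by
      refine ENNReal.ofReal_le_ofReal ?_
      rw [hKcard]
      have := union_count_le hT hδ (hδ2.trans (by norm_num))
      push_cast at this ⊢
      exact this

end Concentration

/-! ### The oracle event -/

section OracleEvent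

variable {X Ω : Type*} [MeasurableSpace X] [MeasurableSpace Ω] {μ : Measure Ω}
  [IsProbabilityMeasure μ] {PX : Measure X} {ν : Measure ℝ} {x : ℕ → Ω → X} {ε : ℕ → Ω → ℝ}
  {vstar : X → ℝ}

theorem map_observations_block (hx : ∀ t, Measurable (x t)) (hε : ∀ t, Measurable (ε t))
    (hxlaw : ∀ t, μ.map (x t) = PX) (hεlaw : ∀ t, μ.map (ε t) = ν)
    (hindep : iIndepFun (fun t ω => (x t ω, ε t ω)) μ)
    (hxε : ∀ t, IndepFun (x t) (ε t) μ) (hv : Measurable vstar) (m n : ℕ) :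
    μ.map (fun ω (i : Fin n) => observations x ε vstar ω (m + i)) =
      Measure.pi (fun _ : Fin n => sampleLaw PX ν vstar) := by
  have hg : Measurable (fun p : X × ℝ => (p.1, vstar p.1 + p.2)) := by fun_prop
  have hpair : ∀ k, Measurable (fun ω => (x k ω, ε k ω)) := fun k => (hx k).prodMk (hε k)
  have h1 := (hindep.comp (fun _ p => (p.1, vstar p.1 + p.2)) (fun _ => hg)).precomp
    (g := fun i : Fin n => m + (i : ℕ)) (fun i j hij => Fin.ext (Nat.add_left_cancel hij))
  have h2 := (iIndepFun_iff_map_fun_eq_pi_map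
    (fun i : Fin n => (hg.comp (hpair (m + i))).aemeasurable)).1 h1
  refine h2.trans ?_
  congr 1
  funext i
  rw [sampleLaw, ← hxlaw (m + i), ← hεlaw (m + i),
    ← (indepFun_iff_map_prod_eq_prod_map_map (hx (m + i)).aemeasurable
      (hε (m + i)).aemeasurable).1 (hxε (m + i)), Measure.map_map hg (hpair _)]

theorem measure_estimator_inaccurate_le {𝒱 : Set (X → ℝ)} {ρ : ℝ → ℝ} {oracle : Oracle X} {δ : ℝ}
    (hx : ∀ t, Measurable (x t)) (hε : ∀ t, Measurable (ε t))
    (hxlaw : ∀ t, μ.map (x t) = PX) (hεlaw : ∀ t, μ.map (ε t) = ν)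
    (hindep : iIndepFun (fun t ω => (x t ω, ε t ω)) μ)
    (hxε : ∀ t, IndepFun (x t) (ε t) μ) (hv : Measurable vstar)
    (ho : IsAdjustedOracle 𝒱 (sampleLaw PX ν vstar) vstar ρ oracle) (hδ : 0 < δ) {e : ℕ}
    (he : e ≠ 0) :
    μ {ω | ¬ ∀ z, |estimator oracle δ (observations x ε vstar ω) e z - vstar z| ≤
      √(ρ δ / (2 ^ (e - 1) : ℕ))} ≤ ENNReal.ofReal δ := by
  have hacc := ho.accuracy (2 ^ (e - 1)) δ Nat.one_le_two_pow hδ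
  rw [← map_observations_block hx hε hxlaw hεlaw hindep hxε hv (2 ^ (e - 1))] at hacc
  -- `Measure.le_map_apply` holds for arbitrary sets, so the event, a condition on all `z`, need not
  -- be measurable.
  refine le_trans ?_ ((Measure.le_map_apply ?_ _).trans hacc)
  · simp only [estimator, if_neg he]
    exact le_rfl
  · exact (measurable_pi_lambda _ fun i =>
      (measurable_pi_apply _).comp (measurable_observations hx hε hv)).aemeasurable

end OracleEvent

/-! ### Arithmetic of the episode lengths -/

theorem numGrid_le {T : ℕ} (hT : 0 < T) : numGrid T ≤ T := by
  have h1 : (1 : ℝ) ≤ T := by exact_mod_cast hT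
  refine Nat.ceil_le.2 ?_
  calc (T : ℝ) ^ (1 / 5 : ℝ) ≤ (T : ℝ) ^ (1 : ℝ) :=
        Real.rpow_le_rpow_of_exponent_le h1 (by norm_num)
    _ = T := Real.rpow_one _

theorem numGrid_le_two_mul {T : ℕ} (hT : 0 < T) :
    (numGrid T : ℝ) ≤ 2 * (T : ℝ) ^ (1 / 5 : ℝ) := by
  have h1 : (1 : ℝ) ≤ T := by exact_mod_cast hT
  have h2 : 1 ≤ (T : ℝ) ^ (1 / 5 : ℝ) := Real.one_le_rpow h1 (by norm_num)
  have := (Nat.ceil_lt_add_one (by positivity : 0 ≤ (T : ℝ) ^ (1 / 5 : ℝ))).le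
  unfold numGrid
  linarith

theorem div_numGrid_sq_le {T : ℕ} (hT : 0 < T) :
    (T : ℝ) / (numGrid T : ℝ) ^ 2 ≤ (T : ℝ) ^ (3 / 5 : ℝ) := by
  have h0 : (0 : ℝ) < T := by exact_mod_cast hT
  have hN : (T : ℝ) ^ (1 / 5 : ℝ) ≤ numGrid T := Nat.le_ceil _
  have hpos : 0 < (T : ℝ) ^ (1 / 5 : ℝ) := by positivity
  calc (T : ℝ) / (numGrid T : ℝ) ^ 2 ≤ (T : ℝ) / ((T : ℝ) ^ (1 / 5 : ℝ)) ^ 2 := by gcongr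
    _ = (T : ℝ) ^ (3 / 5 : ℝ) := by
      rw [div_eq_iff (by positivity), ← Real.rpow_natCast, ← Real.rpow_mul h0.le,
        ← Real.rpow_add h0]
      norm_num

theorem logFactor_le {δ : ℝ} {T e : ℕ} (hT : 2 ≤ T) (he : 2 ^ e ≤ T) (hδ : 0 < δ) (hδ1 : δ ≤ 1) :
    logFactor δ (2 ^ e) ≤ 4 * Real.log (T / δ) := by
  have h2 : (2 : ℝ) ≤ T := by exact_mod_cast hT
  have hS : (numLayers (2 ^ e) : ℝ) ≤ T := by
    exact_mod_cast (numLayers_two_pow_le e).trans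
      ((Nat.succ_le_of_lt Nat.lt_two_pow_self).trans he)
  have hN : (numGrid (2 ^ e) : ℝ) ≤ T := by
    exact_mod_cast (numGrid_le (by positivity)).trans he
  have hE : ((2 ^ e : ℕ) : ℝ) ≤ T := by exact_mod_cast he
  have hS0 : (0 : ℝ) < numLayers (2 ^ e) := by exact_mod_cast one_le_numLayers (2 ^ e)
  have hN0 : (0 : ℝ) < numGrid (2 ^ e) := by
    exact_mod_cast numGrid_pos (T := 2 ^ e) (by positivity)
  rw [show (4 : ℝ) * Real.log (T / δ) = ((4 : ℕ) : ℝ) * Real.log (T / δ) by norm_num,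
    ← Real.log_pow, logFactor]
  refine Real.log_le_log (by positivity) ?_
  rw [div_pow]
  have hδ4 : δ ^ 4 ≤ δ := pow_le_of_le_one hδ.le hδ1 (by norm_num)
  calc 2 * (numLayers (2 ^ e) : ℝ) * numGrid (2 ^ e) * (2 ^ e : ℕ) / δ
      ≤ T * T * T * T / δ := by gcongr
    _ = T ^ 4 / δ := by ring
    _ ≤ T ^ 4 / δ ^ 4 := by gcongr

theorem one_le_log_div {δ : ℝ} {T : ℕ} (hT : 2 ≤ T) (hδ : 0 < δ) (hδ2 : δ ≤ 1 / 2) :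
    1 ≤ Real.log (T / δ) := by
  have h2 : (2 : ℝ) ≤ T := by exact_mod_cast hT
  rw [Real.le_log_iff_exp_le (by positivity), le_div_iff₀ hδ]
  have := Real.exp_one_lt_d9
  nlinarith [Real.exp_pos 1]

theorem ceil_logb_le {δ : ℝ} {T : ℕ} (hT : 2 ≤ T) (hδ : 0 < δ) (hδ2 : δ ≤ 1 / 2) :
    (⌈Real.logb 2 T⌉₊ : ℝ) ≤ 3 * Real.log (T / δ) := by
  have h2 : (2 : ℝ) ≤ T := by exact_mod_cast hT
  have hℓ := one_le_log_div hT hδ hδ2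
  have hlog : Real.log T ≤ Real.log (T / δ) := by
    refine Real.log_le_log (by positivity) ((le_div_iff₀ hδ).2 ?_)
    nlinarith
  have hlog0 : 0 ≤ Real.log T := Real.log_nonneg (by linarith)
  have hlogb : Real.logb 2 T ≤ 2 * Real.log T := by
    rw [Real.logb, div_le_iff₀ (Real.log_pos (by norm_num))]
    nlinarith [Real.log_two_gt_d9]
  have hceil := Nat.ceil_lt_add_one (Real.logb_nonneg (b := 2) (by norm_num)
    (by linarith : (1 : ℝ) ≤ T))
  linarith

/-! ### Assembling the episodes -/

theorem optimal_rev_le {X : Type*} {F : ℝ → ℝ} {vstar pstar : X → ℝ} {B : ℝ} (hB : 0 < B)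
    (hF : ∀ u, F u ∈ Set.Icc (0 : ℝ) 1)
    {Bε : ℝ} (hFB : ∀ u, Bε ≤ u → F u = 1)
    (hv : ∀ z, vstar z ∈ Set.Icc Bε (B - Bε)) (hp0 : ∀ z, 0 ≤ pstar z) (z : X) :
    rev F (vstar z) (pstar z) ≤ B := by
  rcases lt_or_ge (pstar z) B with h | h
  · exact (rev_le_of_nonneg hF (hp0 z)).2.trans h.le
  · rw [rev, hFB _ (by linarith [(hv z).2])]
    simpa using hB.le

theorem sum_range_two_pow {M : Type*} [AddCommMonoid M] (f : ℕ → M) (K : ℕ) :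
    ∑ t ∈ Finset.range (2 ^ K), f t =
      f 0 + ∑ e ∈ Finset.range K, ∑ t ∈ Finset.Ico (2 ^ e) (2 ^ (e + 1)), f t := by
  induction K with
  | zero => simp
  | succ K ih =>
    rw [Finset.sum_range_succ, ← add_assoc, ← ih, Finset.range_eq_Ico, Finset.range_eq_Ico,
      Finset.sum_Ico_consecutive _ (Nat.zero_le _) (pow_le_pow_right₀ (by norm_num) (by omega))]

section Assembly

variable {X : Type*} [MeasurableSpace X] {B : ℝ} (R : SelectionRule X B) (oracle : Oracle X)
  (δ : ℝ) (obs : ℕ → X × ℝ) {F : ℝ → ℝ} {vstar pstar : X → ℝ} {L C : ℝ}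

/-- The factor of the per-episode bound. -/
noncomputable def episodeConst (B L C : ℝ) : ℝ :=
  120 * B + (24 * L * B + 2) + (9 / 4 * C + 4 / B) * (25 * B ^ 2)

/-- An episode bound in terms of the horizon. -/
theorem episode_bound_le {B L C δ r : ℝ} (hB : 0 < B) (hL : 0 ≤ L) (hC : 0 ≤ C) (hr : 0 ≤ r)
    {T e : ℕ} (hT : 2 ≤ T)
    (he0 : e ≠ 0) (he : e < ⌈Real.logb 2 T⌉₊) (heT : 2 ^ e ≤ T) (hδ : 0 < δ) (hδ2 : δ ≤ 1 / 2) :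
    numLayers (2 ^ e) * (8 * B * √(3 * numGrid (2 ^ e) * 2 ^ e * logFactor δ (2 ^ e))) +
      (4 * L * B * numLayers (2 ^ e) + 1) * (2 ^ e * √(r / (2 ^ (e - 1) : ℕ))) +
      (9 / 4 * C + 4 / B) * (2 ^ e * (5 * B / numGrid (2 ^ e)) ^ 2) ≤
    episodeConst B L C *
      (Real.log (T / δ) ^ 2 * max ((T : ℝ) ^ (3 / 5 : ℝ)) (√r * √(T : ℝ))) := by
  set ℓ := Real.log (T / δ) with hℓdef
  set M := max ((T : ℝ) ^ (3 / 5 : ℝ)) (√r * √(T : ℝ)) with hM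
  have hℓ : 1 ≤ ℓ := one_le_log_div hT hδ hδ2
  have hℓ0 : 0 < ℓ := by linarith
  have hT0 : (0 : ℝ) < T := by exact_mod_cast (by omega : 0 < T)
  have hM1 : (T : ℝ) ^ (3 / 5 : ℝ) ≤ M := le_max_left _ _
  have hM2 : √r * √(T : ℝ) ≤ M := le_max_right _ _
  have hT35 : 0 < (T : ℝ) ^ (3 / 5 : ℝ) := by positivity
  have hM0 : 0 < M := hT35.trans_le hM1
  have heT' : (2 : ℝ) ^ e ≤ T := by exact_mod_cast heT
  have hS : (numLayers (2 ^ e) : ℝ) ≤ 3 * ℓ := by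
    refine le_trans ?_ (ceil_logb_le hT hδ hδ2)
    exact_mod_cast (numLayers_two_pow_le e).trans he
  have hℓ2 : ℓ ≤ ℓ ^ 2 := by nlinarith
  have hNpos : (0 : ℝ) < numGrid (2 ^ e) := by
    exact_mod_cast numGrid_pos (T := 2 ^ e) (by positivity)
  -- The constants `3 · 2 · 4 = 24` are rounded up to `25`, and `ℓ` to `ℓ²`, to give a square.
  have h1 : √(3 * numGrid (2 ^ e) * 2 ^ e * logFactor δ (2 ^ e)) ≤
      5 * (ℓ * (T : ℝ) ^ (3 / 5 : ℝ)) := by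
    refine Real.sqrt_le_iff.2 ⟨by positivity, ?_⟩
    have hN : (numGrid (2 ^ e) : ℝ) ≤ 2 * (T : ℝ) ^ (1 / 5 : ℝ) := by
      refine (numGrid_le_two_mul (by positivity)).trans ?_
      gcongr
    have hΛ := logFactor_le hT heT hδ (by linarith)
    have hΛ0 : 0 ≤ logFactor δ (2 ^ e) :=
      zero_le_one.trans (logFactor_ge_one (by positivity) hδ hδ2)
    have hpow : (T : ℝ) ^ (1 / 5 : ℝ) * T = ((T : ℝ) ^ (3 / 5 : ℝ)) ^ 2 := by
      nth_rewrite 2 [← Real.rpow_one (T : ℝ)]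
      rw [← Real.rpow_add hT0, ← Real.rpow_natCast, ← Real.rpow_mul hT0.le]
      norm_num
    calc 3 * (numGrid (2 ^ e) : ℝ) * 2 ^ e * logFactor δ (2 ^ e)
        ≤ 3 * (2 * (T : ℝ) ^ (1 / 5 : ℝ)) * T * (4 * ℓ) := by gcongr
      _ = 24 * ℓ * ((T : ℝ) ^ (1 / 5 : ℝ) * T) := by ring
      _ = 24 * ℓ * ((T : ℝ) ^ (3 / 5 : ℝ)) ^ 2 := by rw [hpow]
      _ ≤ 25 * ℓ ^ 2 * ((T : ℝ) ^ (3 / 5 : ℝ)) ^ 2 := by gcongr; linarith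
      _ = _ := by ring
  have hA : numLayers (2 ^ e) *
      (8 * B * √(3 * numGrid (2 ^ e) * 2 ^ e * logFactor δ (2 ^ e))) ≤
      120 * B * (ℓ ^ 2 * M) := by
    calc _ ≤ 3 * ℓ * (8 * B * (5 * (ℓ * M))) := by
          gcongr
          exact h1.trans (by gcongr)
      _ = _ := by ring
  have h2 : (2 : ℝ) ^ e * √(r / (2 ^ (e - 1) : ℕ)) ≤ 2 * M := by
    have hpow : (2 : ℝ) ^ e = 2 * 2 ^ (e - 1) := by
      rw [← pow_succ', Nat.sub_add_cancel (Nat.one_le_iff_ne_zero.2 he0)]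
    have hsq : √((2 : ℝ) ^ (e - 1)) ≤ √(T : ℝ) := by
      refine Real.sqrt_le_sqrt (le_trans ?_ heT')
      exact pow_le_pow_right₀ (by norm_num) (by omega)
    have hpos : 0 < √((2 : ℝ) ^ (e - 1)) := Real.sqrt_pos.2 (by positivity)
    push_cast
    rw [Real.sqrt_div hr, hpow]
    nth_rewrite 1 [← Real.mul_self_sqrt (by positivity : (0 : ℝ) ≤ 2 ^ (e - 1))]
    calc 2 * (√((2 : ℝ) ^ (e - 1)) * √((2 : ℝ) ^ (e - 1))) * (√r / √((2 : ℝ) ^ (e - 1)))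
        = 2 * (√r * √((2 : ℝ) ^ (e - 1))) := by field_simp
      _ ≤ 2 * (√r * √(T : ℝ)) := by gcongr
      _ ≤ 2 * M := by gcongr
  have hBt : (4 * L * B * numLayers (2 ^ e) + 1) * (2 ^ e * √(r / (2 ^ (e - 1) : ℕ))) ≤
      (24 * L * B + 2) * (ℓ ^ 2 * M) := by
    calc _ ≤ (4 * L * B * (3 * ℓ) + ℓ) * (2 * M) := by gcongr
      _ = (24 * L * B + 2) * (ℓ * M) := by ring
      _ ≤ _ := by gcongr
  have hCt : (9 / 4 * C + 4 / B) * (2 ^ e * (5 * B / numGrid (2 ^ e)) ^ 2) ≤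
      (9 / 4 * C + 4 / B) * (25 * B ^ 2) * (ℓ ^ 2 * M) := by
    have h3 := div_numGrid_sq_le (T := 2 ^ e) (by positivity)
    push_cast at h3
    have h4 : ((2 : ℝ) ^ e) ^ (3 / 5 : ℝ) ≤ (T : ℝ) ^ (3 / 5 : ℝ) := by gcongr
    have h5 : M ≤ ℓ ^ 2 * M := le_mul_of_one_le_left hM0.le (by nlinarith)
    rw [mul_assoc]
    refine mul_le_mul_of_nonneg_left ?_ (by positivity)
    calc (2 : ℝ) ^ e * (5 * B / numGrid (2 ^ e)) ^ 2
        = 25 * B ^ 2 * (2 ^ e / (numGrid (2 ^ e) : ℝ) ^ 2) := by rw [div_pow]; ring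
      _ ≤ 25 * B ^ 2 * (ℓ ^ 2 * M) := by
        gcongr; exact h3.trans (h4.trans (hM1.trans h5))
  unfold episodeConst
  linarith

/-- The regret bound on the event that all estimators are accurate and all sale outcomes
concentrate. -/
theorem regret_le (hB : 0 < B) (hL : 0 ≤ L) (hC : 0 ≤ C)
    (hF : ∀ u, F u ∈ Set.Icc (0 : ℝ) 1) (hFL : ∀ u w, |F u - F w| ≤ L * |u - w|)
    {Bε : ℝ} (hFB : ∀ u, Bε ≤ u → F u = 1) (hBε : 0 ≤ Bε)
    (hv : ∀ z, vstar z ∈ Set.Icc Bε (B - Bε))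
    (hp : ∀ z, 0 ≤ pstar z ∧ ∀ p, 0 ≤ p → rev F (vstar z) p ≤ rev F (vstar z) (pstar z))
    (hsmooth : ∀ z p, 0 ≤ p →
      rev F (vstar z) (pstar z) - rev F (vstar z) p ≤ C * (pstar z - p) ^ 2)
    (hδ : 0 < δ) (hδ2 : δ ≤ 1 / 2) {T : ℕ} (hT : 2 ≤ T) {r : ℝ} (hr : 0 ≤ r)
    (hest : ∀ e < ⌈Real.logb 2 T⌉₊, e ≠ 0 →
      ∀ z, |estimator oracle δ obs e z - vstar z| ≤ √(r / (2 ^ (e - 1) : ℕ)))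
    (hgood : ∀ e < ⌈Real.logb 2 T⌉₊, Concentrates R oracle δ obs F vstar e) :
    regret R oracle δ F vstar pstar obs T ≤
      (2 * B + 3 * episodeConst B L C) * Real.log (T / δ) ^ 3 *
        max ((T : ℝ) ^ (3 / 5 : ℝ)) (√r * √(T : ℝ)) := by
  have hp0 : ∀ z, 0 ≤ pstar z := fun z => (hp z).1
  set g : ℕ → ℝ := fun t => rev F (vstar (obs t).1) (pstar (obs t).1) -
    rev F (vstar (obs t).1) (decision R oracle δ obs t).price with hg
  set K := ⌈Real.logb 2 T⌉₊ with hK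
  set ℓ := Real.log (T / δ) with hℓdef
  set M := max ((T : ℝ) ^ (3 / 5 : ℝ)) (√r * √(T : ℝ)) with hM
  have hT0 : (1 : ℝ) ≤ T := by exact_mod_cast (by omega : 1 ≤ T)
  have hℓ : 1 ≤ ℓ := one_le_log_div hT hδ hδ2
  have hM1 : 1 ≤ M := (Real.one_le_rpow hT0 (by norm_num)).trans (le_max_left _ _)
  have hKℓ : (K : ℝ) ≤ 3 * ℓ := ceil_logb_le hT hδ hδ2
  have hKclog : K = Nat.clog 2 T := by
    rw [hK]; exact_mod_cast Real.natCeil_logb_natCast 2 T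
  have hTK : T ≤ 2 ^ K := by rw [hKclog]; exact Nat.le_pow_clog (by norm_num) T
  have heT : ∀ e < K, 2 ^ e ≤ T := fun e he =>
    ((Nat.lt_clog_iff_pow_lt (by norm_num)).1 (hKclog ▸ he)).le
  -- Optimality of `pstar` makes each round's regret nonnegative, so the horizon may be extended to
  -- the end of the last, perhaps unfinished, episode.
  have hg0 : ∀ t, 0 ≤ g t := fun t =>
    sub_nonneg.2 ((hp _).2 _ (decision_price_mem R oracle δ obs hB.le t).1)
  have hgB : ∀ t, g t ≤ B := by
    intro t
    have h1 := optimal_rev_le hB hF hFB hv hp0 (obs t).1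
    have h2 := (rev_le_of_nonneg hF (q := vstar (obs t).1)
      (decision_price_mem R oracle δ obs hB.le t).1).1
    simp only [hg]; linarith
  have hA0 : 0 ≤ episodeConst B L C := by unfold episodeConst; positivity
  have hep : ∀ e ∈ Finset.range K, ∑ t ∈ Finset.Ico (2 ^ e) (2 ^ (e + 1)), g t ≤
      (if e = 0 then B else 0) + episodeConst B L C * (ℓ ^ 2 * M) := by
    intro e he
    have heK := Finset.mem_range.1 he
    -- The first episode is a single round, with no oracle guarantee; its regret is bounded by `B`.
    rcases eq_or_ne e 0 with rfl | he0
    · have : 0 ≤ episodeConst B L C * (ℓ ^ 2 * M) := by positivity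
      simp only [if_true]
      have h1 := hgB 1
      simp only [pow_zero, zero_add, pow_one]
      rw [Finset.sum_Ico_succ_top (by norm_num)]
      simp only [Finset.Ico_self, Finset.sum_empty, zero_add]
      linarith
    · rw [if_neg he0, zero_add]
      exact (episode_regret_le R oracle δ obs hB hL hC hF hFL hFB hBε hv hp0 hsmooth hδ hδ2
        (hest e heK he0) (hgood e heK)).trans
        (episode_bound_le hB hL hC hr hT he0 heK (heT e heK) hδ hδ2)
  have hite : ∑ e ∈ Finset.range K, (if e = 0 then B else 0) ≤ B := by
    rw [Finset.sum_ite_eq']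
    split_ifs
    · exact le_rfl
    · exact hB.le
  calc regret R oracle δ F vstar pstar obs T = ∑ t ∈ Finset.range T, g t := rfl
    _ ≤ ∑ t ∈ Finset.range (2 ^ K), g t :=
      Finset.sum_le_sum_of_subset_of_nonneg (Finset.range_mono hTK) fun t _ _ => hg0 t
    _ = g 0 + ∑ e ∈ Finset.range K, ∑ t ∈ Finset.Ico (2 ^ e) (2 ^ (e + 1)), g t :=
      sum_range_two_pow g K
    _ ≤ B + (B + K * (episodeConst B L C * (ℓ ^ 2 * M))) := by
      refine add_le_add (hgB 0) ((Finset.sum_le_sum hep).trans ?_)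
      rw [Finset.sum_add_distrib, Finset.sum_const, Finset.card_range, nsmul_eq_mul]
      linarith
    -- The three logarithms come from the number of episodes, the number of layers and the
    -- confidence radius.
    _ ≤ B * (ℓ ^ 3 * M) + (B * (ℓ ^ 3 * M) + 3 * ℓ * (episodeConst B L C * (ℓ ^ 2 * M))) := by
      have h1 : B ≤ B * (ℓ ^ 3 * M) := le_mul_of_one_le_right hB.le
        (one_le_mul_of_one_le_of_one_le (one_le_pow₀ hℓ) hM1)
      gcongr
    _ = _ := by ring

end Assembly

end ContextualPricing

/-! ### Union bound over the episodes. -/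

theorem mainTheorem6 :
    ∃ a : ℕ, ∀ B L C : ℝ, 0 < B → 0 < L → 0 < C → ∃ c : ℝ, 0 < c ∧
      ∀ (X : Type*) [MeasurableSpace X] (Ω : Type*) [MeasurableSpace Ω]
        (μ : MeasureTheory.Measure Ω) [MeasureTheory.IsProbabilityMeasure μ]
        (PX : MeasureTheory.Measure X) [MeasureTheory.IsProbabilityMeasure PX]
        (ν : MeasureTheory.Measure ℝ) [MeasureTheory.IsProbabilityMeasure ν]
        (x : ℕ → Ω → X) (ε : ℕ → Ω → ℝ)
        (𝒱 : Set (X → ℝ)) (vstar pstar : X → ℝ) (Bε : ℝ) (ρ : ℝ → ℝ)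
        (oracle : ContextualPricing.Oracle X) (R : ContextualPricing.SelectionRule X B)
        (T : ℕ) (δ : ℝ),
        -- contexts i.i.d., noise i.i.d. with law `ν` and mean zero, everything independent
        (∀ t, Measurable (x t)) → (∀ t, Measurable (ε t)) →
        (∀ t, μ.map (x t) = PX) → (∀ t, μ.map (ε t) = ν) →
        ProbabilityTheory.iIndepFun (fun t ω => (x t ω, ε t ω)) μ →
        (∀ t, ProbabilityTheory.IndepFun (x t) (ε t) μ) →
        ∫ e, e ∂ν = 0 →
        -- realizability
        vstar ∈ 𝒱 → Measurable vstar →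
        -- bounded valuation
        0 < Bε → (∀ᵐ e ∂ν, |e| ≤ Bε) → (∀ z, vstar z ∈ Set.Icc Bε (B - Bε)) →
        -- Lipschitz continuity of the noise distribution function
        (∀ u w, |ProbabilityTheory.cdf ν u - ProbabilityTheory.cdf ν w| ≤ L * |u - w|) →
        -- `pstar z` is an optimal price at the context `z`
        (∀ z, 0 ≤ pstar z ∧ ∀ p, 0 ≤ p →
          ContextualPricing.rev (ProbabilityTheory.cdf ν) (vstar z) p ≤
            ContextualPricing.rev (ProbabilityTheory.cdf ν) (vstar z) (pstar z)) →
        -- second-order smoothness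
        (∀ z p, 0 ≤ p →
          ContextualPricing.rev (ProbabilityTheory.cdf ν) (vstar z) (pstar z) -
            ContextualPricing.rev (ProbabilityTheory.cdf ν) (vstar z) p ≤ C * (pstar z - p) ^ 2) →
        -- adjusted offline regression oracle
        (∀ η, 0 < η → 0 ≤ ρ η) →
        ContextualPricing.IsAdjustedOracle 𝒱 (ContextualPricing.sampleLaw PX ν vstar) vstar ρ
          oracle →
        -- horizon and confidence parameter
        2 ≤ T → 0 < δ → δ < 1 / (2 * (⌈Real.logb 2 T⌉₊ : ℝ)) →
        μ {ω | c * Real.log (T / δ) ^ a * max ((T : ℝ) ^ (3 / 5 : ℝ)) (√(ρ δ) * √(T : ℝ)) <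
            ContextualPricing.regret R oracle δ (ProbabilityTheory.cdf ν) vstar pstar
              (fun t => (x t ω, vstar (x t ω) + ε t ω)) T} ≤
          ENNReal.ofReal (2 * (⌈Real.logb 2 T⌉₊ : ℝ) * δ) := by
  refine ⟨3, fun B L C hB hL hC =>
    ⟨2 * B + 3 * ContextualPricing.episodeConst B L C, ?_, ?_⟩⟩
  · unfold ContextualPricing.episodeConst; positivity
  intro X _ Ω _ μ _ PX _ ν _ x ε 𝒱 vstar pstar Bε ρ oracle R T δ hx hε hxlaw hεlaw hindep hxε _ _
    hv hBε hεB hvB hFL hp hsmooth hρ ho hT hδ hδK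
  have hF : ∀ u, ProbabilityTheory.cdf ν u ∈ Set.Icc (0 : ℝ) 1 := fun u =>
    ⟨ProbabilityTheory.cdf_nonneg ν u, ProbabilityTheory.cdf_le_one ν u⟩
  have hFB : ∀ u, Bε ≤ u → ProbabilityTheory.cdf ν u = 1 := by
    intro u hu
    have h1 : ν (Set.Iic u) = 1 := by
      rw [MeasureTheory.prob_compl_eq_zero_iff measurableSet_Iic |>.symm]
      refine MeasureTheory.measure_mono_null ?_ (MeasureTheory.ae_iff.1 hεB)
      intro e he
      exact fun h => he (((abs_le.1 h).2.trans hu))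
    rw [ProbabilityTheory.cdf_eq_real, MeasureTheory.measureReal_def, h1, ENNReal.toReal_one]
  set K := ⌈Real.logb 2 T⌉₊ with hK
  have hT1 : (1 : ℝ) < T := by exact_mod_cast (by omega : 1 < T)
  have hKpos : 0 < K := Nat.ceil_pos.2 (Real.logb_pos (by norm_num) hT1)
  have hK1 : (1 : ℝ) ≤ K := by exact_mod_cast hKpos
  have hδ2 : δ ≤ 1 / 2 := by
    refine hδK.le.trans (one_div_le_one_div_of_le (by norm_num) ?_)
    linarith
  have hmo : ContextualPricing.MeasurableOracle oracle δ :=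
    ⟨fun n hn => ho.measurable_eval n δ hn hδ, fun n hn => ho.measurable_supNorm n δ hn hδ⟩
  let E₁ : ℕ → Set Ω := fun e => {ω | e ≠ 0 ∧ ¬ ∀ z,
    |ContextualPricing.estimator oracle δ (ContextualPricing.observations x ε vstar ω) e z -
      vstar z| ≤ √(ρ δ / (2 ^ (e - 1) : ℕ))}
  let E₂ : ℕ → Set Ω := fun e => {ω | ¬ ContextualPricing.Concentrates R oracle δ
    (ContextualPricing.observations x ε vstar ω) (ProbabilityTheory.cdf ν) vstar e}
  have hE₁ : ∀ e, μ (E₁ e) ≤ ENNReal.ofReal δ := by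
    intro e
    rcases eq_or_ne e 0 with rfl | he
    · simp [E₁]
    · refine (MeasureTheory.measure_mono fun ω hω => hω.2).trans
        (ContextualPricing.measure_estimator_inaccurate_le hx hε hxlaw hεlaw hindep hxε hv ho hδ he)
  have hE₂ : ∀ e, μ (E₂ e) ≤ ENNReal.ofReal δ := fun e =>
    ContextualPricing.measure_not_concentrates_le R hmo hx hε hxlaw hεlaw hindep hxε hv hFL hδ
      hδ2 e
  -- Off these bad events `regret_le` applies pointwise; each of the `K` episodes contributes at
  -- most `2δ`.
  calc _ ≤ μ (⋃ e ∈ Finset.range K, (E₁ e ∪ E₂ e)) := by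
        refine MeasureTheory.measure_mono fun ω hω => ?_
        by_contra hgood
        simp only [Set.mem_iUnion, Set.mem_union, Finset.mem_range, not_exists, not_or] at hgood
        refine absurd (Set.mem_ofPred_eq.mp hω) (not_lt.2 ?_)
        refine ContextualPricing.regret_le R oracle δ
          (ContextualPricing.observations x ε vstar ω) hB hL.le hC.le hF hFL hFB hBε.le hvB hp
          hsmooth hδ hδ2 hT (hρ δ hδ) (fun e he he0 => ?_) (fun e he => ?_)
        · by_contra h
          exact (hgood e he).1 ⟨he0, h⟩
        · by_contra h
          exact (hgood e he).2 h
    _ ≤ ∑ e ∈ Finset.range K, μ (E₁ e ∪ E₂ e) := MeasureTheory.measure_biUnion_finset_le _ _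
    _ ≤ ∑ e ∈ Finset.range K, ENNReal.ofReal (2 * δ) := by
        refine Finset.sum_le_sum fun e _ => (MeasureTheory.measure_union_le _ _).trans ?_
        rw [two_mul, ENNReal.ofReal_add hδ.le hδ.le]
        exact add_le_add (hE₁ e) (hE₂ e)
    _ = ENNReal.ofReal (2 * (K : ℝ) * δ) := by
        rw [Finset.sum_const, Finset.card_range, nsmul_eq_mul, ← ENNReal.ofReal_natCast,
          ← ENNReal.ofReal_mul (by positivity)]
        congr 1
        ring
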